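/- Let $G=(V,E)$ be a finite simple graph with $n=|V|$ and $m=|E|$, and let $w\in\mathbb R_{+}^{E}$ be a nonnegative weight function. For $r\in V$, an $r$-acyclic orientation of $G$ is an orientation of the edges such that the resulting digraph is acyclic and $r$ is its unique vertex of indegree $0$. For such an orientation $OE$, let $k_d(G,OE,w,r)$ be the maximum of $\sum_{i=1}^t\lambda_i$ over all packings of $r$-arborescences, i.e. families $(\lambda_1,A_1),\dots,(\lambda_t,A_t)$ of positive reals $\lambda_i$ and spanning $r$-arborescences $A_i$ of $(V,OE)$ with $\sum_{i:\,a\in A_i}\lambda_i\le w(a)$ for every arc $a$ (an arc has the weight of its edge). Put $k(G,w,r)=\max_{OE}k_d(G,OE,w,r)$, over all $r$-acyclic orientations $OE$ of $G$, and $k(G,w)=\max_{r\in V}k(G,w,r)$. The problem rBRP asks, given $(G,w,r)$, for $k(G,w,r)$, an $r$-acyclic orientation attaining it, and a packing of $r$-arborescences of that orientation of value $k(G,w,r)$; BRP asks, given $(G,w)$, for $k(G,w)$ together with a root $r$, an $r$-acyclic orientation and a packing attaining it. A graph is outerplanar if it has a planar drawing with all vertices on the boundary of the outer face. An outer circuit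 of a simple 2-connected outerplanar graph (which has at least three vertices) is the cycle that bounds the outer face in such a drawing; it passes through all vertices, and the chords of $G$ are the edges that do not lie on it, so that their number is $k=m-n$. Running times are numbers of steps of a real RAM: a machine with registers and arrays of natural and of real numbers, in which every memory access, every addition, subtraction or comparison (of two natural or of two real numbers) and every assignment takes one step. $G$ is given by $n$, $m$ and a list of its edges with their weights. Theorem. On simple 2-connected outerplanar graphs: (1) There is an algorithm that, given $(G,w,r)$, computes in $O((k+1)m)$ steps, where $k$ is the number of chords of $G$, the value $k(G,w,r)$ and an $r$-acyclic orientation $OE$ of $G$ with $k_d(G,OE,w,r)=k(G,w,r)$ whose minimum weighted indegree $\min_{v\in V\setminus\{r\}}w(\delta^-_{OE}(v))$ equals $k(G,w,r)$. (2) rBRP can be solved in polynomial time. (3) BRP can be solved in polynomial time. -/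

import Mathlib

namespace Broadcast

/-! ### Rooted acyclic orientations, arborescences and packings -/

section Packing

variable {V : Type*}

/-- `D` is an orientation of `G`: each edge of `G` gets exactly one of its two directions. -/
structure IsOrientation (G : SimpleGraph V) (D : Digraph V) : Prop where
  adj_iff : ∀ u v, G.Adj u v ↔ D.Adj u v ∨ D.Adj v u
  asymm : ∀ u v, D.Adj u v → ¬ D.Adj v u

/-- An `r`-acyclic orientation of `G`: an orientation without directed cycles in which `r` is the
unique vertex of indegree `0`. -/
structure IsRootedAcyclic (G : SimpleGraph V) (r : V) (D : Digraph V) : Prop where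
  orientation : IsOrientation G D
  acyclic : ∀ v, ¬ Relation.TransGen D.Adj v v
  source_iff : ∀ v, (∀ u, ¬ D.Adj u v) ↔ v = r

/-- A (spanning) `r`-arborescence `A` of the digraph `D`. -/
structure IsArborescence (D : Digraph V) (r : V) (A : Digraph V) : Prop where
  le : ∀ u v, A.Adj u v → D.Adj u v
  root : ∀ u, ¬ A.Adj u r
  parent : ∀ v, v ≠ r → ∃! u, A.Adj u v
  reachable : ∀ v, Relation.ReflTransGen A.Adj r v

open Classical in
/-- Pairs `(lam 0, A 0), …, (lam (t-1), A (t-1))` of positive reals and `r`-arborescences of `D`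
such that the total weight put on each arc is at most the weight of the underlying edge. -/
structure IsPacking (D : Digraph V) (w : Sym2 V → ℝ) (r : V) {t : ℕ}
    (lam : Fin t → ℝ) (A : Fin t → Digraph V) : Prop where
  pos : ∀ j, 0 < lam j
  arborescence : ∀ j, IsArborescence D r (A j)
  capacity : ∀ u v, D.Adj u v → (∑ j, if (A j).Adj u v then lam j else 0) ≤ w s(u, v)

/-- The values of the packings of `r`-arborescences of `D`. -/
def packingValues (D : Digraph V) (w : Sym2 V → ℝ) (r : V) : Set ℝ :=
  {x | ∃ (t : ℕ) (lam : Fin t → ℝ) (A : Fin t → Digraph V),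
    IsPacking D w r lam A ∧ x = ∑ j, lam j}

/-- `k_d(G, OE, w, r)`, the maximum value of a packing of `r`-arborescences of `D`. -/
noncomputable def kd (D : Digraph V) (w : Sym2 V → ℝ) (r : V) : ℝ :=
  sSup (packingValues D w r)

/-- The values `k_d(G, OE, w, r)` over all `r`-acyclic orientations `OE` of `G`. -/
def rootedValues (G : SimpleGraph V) (w : Sym2 V → ℝ) (r : V) : Set ℝ :=
  {x | ∃ D : Digraph V, IsRootedAcyclic G r D ∧ x = kd D w r}

/-- `k(G, w, r)`. -/
noncomputable def kRooted (G : SimpleGraph V) (w : Sym2 V → ℝ) (r : V) : ℝ :=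
  sSup (rootedValues G w r)

/-- The values `k(G, w, r)` over all vertices `r`; the maximum of this set is `k(G, w)`. -/
def broadcastValues (G : SimpleGraph V) (w : Sym2 V → ℝ) : Set ℝ :=
  {x | ∃ r : V, x = kRooted G w r}

open Classical in
/-- The weight of the set of arcs of `D` that enter `v`. -/
noncomputable def inWeight [Fintype V] (D : Digraph V) (w : Sym2 V → ℝ) (v : V) : ℝ :=
  ∑ u, if D.Adj u v then w s(u, v) else 0

end Packing

/-! ### Simple 2-connected outerplanar graphs -/

section Outerplanar

variable {V : Type*}

/-- 2-connected: at least three vertices, connected, and without cut vertex. -/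
structure IsTwoConnected (G : SimpleGraph V) : Prop where
  three_le : 3 ≤ Nat.card V
  connected : G.Connected
  no_cut : ∀ v, (G.induce {v}ᶜ).Connected

/-- A planar drawing of `G`: distinct points for distinct vertices, a simple arc between the
endpoints for each edge; arcs pass through no other vertex and meet only in common endpoints. -/
structure PlanarDrawing (G : SimpleGraph V) where
  point : V → ℝ × ℝ
  arc : Sym2 V → Set (ℝ × ℝ)
  point_injective : Function.Injective point
  arc_spec : ∀ u v, G.Adj u v → ∃ γ : unitInterval → ℝ × ℝ, Continuous γ ∧
    Function.Injective γ ∧ γ 0 = point u ∧ γ 1 = point v ∧ Set.range γ = arc s(u, v)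
  vertex_on_arc : ∀ e ∈ G.edgeSet, ∀ x, point x ∈ arc e → x ∈ e
  arc_inter : ∀ e ∈ G.edgeSet, ∀ f ∈ G.edgeSet, e ≠ f → arc e ∩ arc f ⊆ Set.range point

/-- The set of points of the plane that are covered by the drawing. -/
def PlanarDrawing.carrier {G : SimpleGraph V} (Γ : PlanarDrawing G) : Set (ℝ × ℝ) :=
  Set.range Γ.point ∪ ⋃ e ∈ G.edgeSet, Γ.arc e

/-- The outer face: the unbounded connected component of the complement of the drawing. -/
def PlanarDrawing.outerFace {G : SimpleGraph V} (Γ : PlanarDrawing G) : Set (ℝ × ℝ) :=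
  {p | p ∈ Γ.carrierᶜ ∧ ¬ Bornology.IsBounded (connectedComponentIn Γ.carrierᶜ p)}

/-- All vertices lie on the (boundary of the) outer face. -/
def PlanarDrawing.IsOuter {G : SimpleGraph V} (Γ : PlanarDrawing G) : Prop :=
  ∀ v, Γ.point v ∈ frontier Γ.outerFace

/-- `G` has a planar drawing for which all vertices belong to the outer face. -/
def IsOuterplanar (G : SimpleGraph V) : Prop :=
  ∃ Γ : PlanarDrawing G, Γ.IsOuter

/-- `c` is an outer circuit of `G`: a cycle of `G` that bounds the outer face of some drawing with
all vertices on the outer face. -/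
def IsOuterCircuit {G : SimpleGraph V} {u : V} (c : G.Walk u u) : Prop :=
  c.IsCycle ∧ ∃ Γ : PlanarDrawing G, Γ.IsOuter ∧
    frontier Γ.outerFace = ⋃ e ∈ {e | e ∈ c.edges}, Γ.arc e

/-- The number of chords of `G` with respect to the circuit `c`: edges of `G` not on `c`. -/
noncomputable def numChords {G : SimpleGraph V} {u : V} (c : G.Walk u u) : ℕ :=
  (G.edgeSet \ {e | e ∈ c.edges}).ncard

end Outerplanar

/-! ### The machine model

A real RAM: structured programs over natural-number and real registers and arrays (array names
are fixed in the program, indices are computed). Natural numbers can be added, subtracted (with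
truncation at `0`) and compared; real numbers can be added, subtracted and compared, and the only
real constant is `0`. Each operation, memory access, assignment and test takes one step. -/

/-- The memory of the machine. -/
structure Store where
  natVar : ℕ → ℕ
  natArr : ℕ → ℕ → ℕ
  realVar : ℕ → ℝ
  realArr : ℕ → ℕ → ℝ

/-- Natural-number expressions. -/
inductive NExp where
  | lit (c : ℕ)
  | var (x : ℕ)
  | get (a : ℕ) (i : NExp)
  | plus (e f : NExp)
  | minus (e f : NExp)

/-- Real expressions. -/
inductive RExp where
  | zero
  | var (x : ℕ)
  | get (a : ℕ) (i : NExp)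
  | plus (e f : RExp)
  | minus (e f : RExp)

/-- Tests. -/
inductive BExp where
  | natLe (e f : NExp)
  | realLe (e f : RExp)
  | neg (b : BExp)
  | both (b c : BExp)

/-- Value of a natural-number expression. -/
def NExp.eval (s : Store) : NExp → ℕ
  | .lit c => c
  | .var x => s.natVar x
  | .get a i => s.natArr a (i.eval s)
  | .plus e f => e.eval s + f.eval s
  | .minus e f => e.eval s - f.eval s

/-- Number of steps for evaluating a natural-number expression. -/
def NExp.cost : NExp → ℕ
  | .lit _ => 1
  | .var _ => 1
  | .get _ i => i.cost + 1
  | .plus e f => e.cost + f.cost + 1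
  | .minus e f => e.cost + f.cost + 1

/-- Value of a real expression. -/
noncomputable def RExp.eval (s : Store) : RExp → ℝ
  | .zero => 0
  | .var x => s.realVar x
  | .get a i => s.realArr a (i.eval s)
  | .plus e f => e.eval s + f.eval s
  | .minus e f => e.eval s - f.eval s

/-- Number of steps for evaluating a real expression. -/
def RExp.cost : RExp → ℕ
  | .zero => 1
  | .var _ => 1
  | .get _ i => i.cost + 1
  | .plus e f => e.cost + f.cost + 1
  | .minus e f => e.cost + f.cost + 1

/-- Truth of a test. -/
def BExp.Holds (s : Store) : BExp → Prop
  | .natLe e f => e.eval s ≤ f.eval s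
  | .realLe e f => e.eval s ≤ f.eval s
  | .neg b => ¬ b.Holds s
  | .both b c => b.Holds s ∧ c.Holds s

/-- Number of steps for evaluating a test. -/
def BExp.cost : BExp → ℕ
  | .natLe e f => e.cost + f.cost + 1
  | .realLe e f => e.cost + f.cost + 1
  | .neg b => b.cost + 1
  | .both b c => b.cost + c.cost + 1

/-- Programs. -/
inductive Prog where
  | skip
  | setNat (x : ℕ) (e : NExp)
  | putNat (a : ℕ) (i e : NExp)
  | setReal (x : ℕ) (e : RExp)
  | putReal (a : ℕ) (i : NExp) (e : RExp)
  | seq (p q : Prog)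
  | branch (b : BExp) (p q : Prog)
  | loop (b : BExp) (p : Prog)

/-- `Exec p s T s'`: the program `p`, started on the memory `s`, halts after exactly `T` steps on
the memory `s'`. (`loop b p` repeats `p` as long as `b` holds.) -/
inductive Exec : Prog → Store → ℕ → Store → Prop
  | skip (s : Store) : Exec .skip s 1 s
  | setNat (s : Store) (x : ℕ) (e : NExp) :
      Exec (.setNat x e) s (e.cost + 1)
        { s with natVar := Function.update s.natVar x (e.eval s) }
  | putNat (s : Store) (a : ℕ) (i e : NExp) :
      Exec (.putNat a i e) s (i.cost + e.cost + 1)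
        { s with natArr :=
            Function.update s.natArr a (Function.update (s.natArr a) (i.eval s) (e.eval s)) }
  | setReal (s : Store) (x : ℕ) (e : RExp) :
      Exec (.setReal x e) s (e.cost + 1)
        { s with realVar := Function.update s.realVar x (e.eval s) }
  | putReal (s : Store) (a : ℕ) (i : NExp) (e : RExp) :
      Exec (.putReal a i e) s (i.cost + e.cost + 1)
        { s with realArr :=
            Function.update s.realArr a (Function.update (s.realArr a) (i.eval s) (e.eval s)) }
  | seq {p q : Prog} {s s' s'' : Store} {T T' : ℕ} :
      Exec p s T s' → Exec q s' T' s'' → Exec (.seq p q) s (T + T') s''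
  | branch_true {b : BExp} {p q : Prog} {s s' : Store} {T : ℕ} :
      b.Holds s → Exec p s T s' → Exec (.branch b p q) s (b.cost + 1 + T) s'
  | branch_false {b : BExp} {p q : Prog} {s s' : Store} {T : ℕ} :
      ¬ b.Holds s → Exec q s T s' → Exec (.branch b p q) s (b.cost + 1 + T) s'
  | loop_true {b : BExp} {p : Prog} {s s' s'' : Store} {T T' : ℕ} :
      b.Holds s → Exec p s T s' → Exec (.loop b p) s' T' s'' →
        Exec (.loop b p) s (b.cost + 1 + T + T') s''
  | loop_false {b : BExp} {p : Prog} {s : Store} :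
      ¬ b.Holds s → Exec (.loop b p) s (b.cost + 1) s

/-! ### Input and output -/

section InputOutput

variable {n m : ℕ} {G : SimpleGraph (Fin n)}

/-- A listing of the edges of `G`, each exactly once, as pairs of endpoints in any order. -/
structure EdgeList (G : SimpleGraph (Fin n)) (m : ℕ) where
  src : Fin m → Fin n
  dst : Fin m → Fin n
  injective : Function.Injective fun i => s(src i, dst i)
  range_eq : Set.range (fun i => s(src i, dst i)) = G.edgeSet

/-- The initial memory: register `0` holds `n`, register `1` holds `m`, register `2` holds `root`,
natural arrays `0` and `1` hold the endpoints of the edges, real array `0` holds their weights;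
everything else is `0`. -/
def inputStore (L : EdgeList G m) (w : Sym2 (Fin n) → ℝ) (root : ℕ) : Store where
  natVar := fun x => if x = 0 then n else if x = 1 then m else if x = 2 then root else 0
  natArr := fun a i =>
    if h : i < m then
      if a = 0 then (L.src ⟨i, h⟩ : ℕ) else if a = 1 then (L.dst ⟨i, h⟩ : ℕ) else 0
    else 0
  realVar := fun _ => 0
  realArr := fun a i => if h : i < m then
      if a = 0 then w s(L.src ⟨i, h⟩, L.dst ⟨i, h⟩) else 0
    else 0

/-- The orientation in the memory: the `i`-th edge goes from its first to its second listed
endpoint if entry `i` of the natural array `2` is `0`, and the other way otherwise. -/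
def outDigraph (L : EdgeList G m) (s : Store) : Digraph (Fin n) where
  Adj u v := ∃ i : Fin m,
    (s.natArr 2 i = 0 ∧ u = L.src i ∧ v = L.dst i) ∨
    (s.natArr 2 i ≠ 0 ∧ u = L.dst i ∧ v = L.src i)

/-- The coefficients of the packing in the memory (their number is in natural register `3`). -/
def outCoeff (s : Store) (j : Fin (s.natVar 3)) : ℝ := s.realArr 1 j

/-- The `j`-th arborescence in the memory: the parent of `v ≠ r` is entry `j * n + v` of the
natural array `3`. -/
def outTree (s : Store) (r : Fin n) (j : Fin (s.natVar 3)) : Digraph (Fin n) where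
  Adj u v := v ≠ r ∧ s.natArr 3 (j * n + v) = u

/-- The memory holds an optimal `r`-acyclic orientation of `G`, whose minimum weighted indegree
(over the vertices other than `r`) is the value `k(G, w, r)` held in real register `0`. -/
structure HoldsOrientation (L : EdgeList G m) (w : Sym2 (Fin n) → ℝ) (r : Fin n)
    (s : Store) : Prop where
  rootedAcyclic : IsRootedAcyclic G r (outDigraph L s)
  value : s.realVar 0 = kRooted G w r
  min_inWeight : IsLeast {x | ∃ v, v ≠ r ∧ x = inWeight (outDigraph L s) w v} (kRooted G w r)
  max_packing : kd (outDigraph L s) w r = kRooted G w r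
  max_orientation : IsGreatest (rootedValues G w r) (kRooted G w r)

/-- The memory holds a solution of rBRP: an optimal `r`-acyclic orientation, the value
`k(G, w, r)`, and a packing of `r`-arborescences of that orientation with this value, which is
the largest possible. -/
structure HoldsRootedSolution (L : EdgeList G m) (w : Sym2 (Fin n) → ℝ) (r : Fin n)
    (s : Store) : Prop extends HoldsOrientation L w r s where
  packing : IsPacking (outDigraph L s) w r (outCoeff s) (outTree s r)
  packing_value : ∑ j, outCoeff s j = kRooted G w r
  packing_max : IsGreatest (packingValues (outDigraph L s) w r) (kRooted G w r)

/-- The memory holds a solution of BRP: natural register `2` holds a root `r` for which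
`k(G, w, r)` is the maximum `k(G, w)` over all roots, with a solution of rBRP for it. -/
def HoldsSolution (L : EdgeList G m) (w : Sym2 (Fin n) → ℝ) (s : Store) : Prop :=
  ∃ r : Fin n, s.natVar 2 = r ∧ HoldsRootedSolution L w r s ∧
    IsGreatest (broadcastValues G w) (kRooted G w r)

end InputOutput

end Broadcast

/-!
In every `r`-acyclic orientation the packing number equals the minimum weighted indegree of the
vertices other than `r`. It is at most that, since every arborescence enters each vertex.
Conversely, as the orientation is acyclic, any choice of one entering arc for each `v ≠ r` is an
arborescence. As long as the packing has a smaller value than the minimum indegree, some arc with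
positive remaining capacity enters each `v ≠ r`; subtracting the largest possible multiple of the
arborescence so chosen exhausts an arc or completes the packing, so `m + 1` rounds suffice.

An orientation with the largest minimum indegree comes from a greedy order of the vertices: start
with `r`, and always append the vertex that receives the largest total weight from the vertices
already placed, orienting every edge towards its later end. If some orientation gives every vertex
indegree at least `x`, then, as long as a vertex is missing from the order, the first missing vertex
in a topological order of that orientation has all its in-neighbours placed, so it receives at
least `x`, and hence so does the vertex appended.

One greedy step costs time proportional to the frontier, the set of vertices outside the order with
a neighbour in it. When every degree is at least two, the frontier has at most `2 (m - n + 1)`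
vertices, which gives the running time `O((k + 1) m)`.
-/

namespace Broadcast

section ProgramLogic

attribute [simp] NExp.eval NExp.cost RExp.eval RExp.cost BExp.Holds BExp.cost

notation:60 p:61 "⨾" q:60 => Prog.seq p q

/-- A register or a whole array of the machine, of natural or of real numbers. -/
inductive Loc where
  | natVar (x : ℕ)
  | natArr (a : ℕ)
  | realVar (x : ℕ)
  | realArr (a : ℕ)
deriving DecidableEq

/-- The registers and arrays that occur as the target of an assignment in a program. -/
def Prog.writes : Prog → List Loc
  | .skip => []
  | .setNat x _ => [.natVar x]
  | .putNat a _ _ => [.natArr a]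
  | .setReal x _ => [.realVar x]
  | .putReal a _ _ => [.realArr a]
  | .seq p q => p.writes ++ q.writes
  | .branch _ p q => p.writes ++ q.writes
  | .loop _ p => p.writes

/-- The memories `s` and `s'` agree on all registers and arrays outside `W`. -/
structure Frame (W : List Loc) (s s' : Store) : Prop where
  natVar : ∀ x, .natVar x ∉ W → s'.natVar x = s.natVar x
  natArr : ∀ a, .natArr a ∉ W → s'.natArr a = s.natArr a
  realVar : ∀ x, .realVar x ∉ W → s'.realVar x = s.realVar x
  realArr : ∀ a, .realArr a ∉ W → s'.realArr a = s.realArr a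

theorem Frame.refl (W : List Loc) (s : Store) : Frame W s s :=
  ⟨fun _ _ => rfl, fun _ _ => rfl, fun _ _ => rfl, fun _ _ => rfl⟩

theorem Frame.trans {W : List Loc} {s s' s'' : Store} (h : Frame W s s') (h' : Frame W s' s'') :
    Frame W s s'' :=
  ⟨fun x hx => (h'.natVar x hx).trans (h.natVar x hx),
    fun a ha => (h'.natArr a ha).trans (h.natArr a ha),
    fun x hx => (h'.realVar x hx).trans (h.realVar x hx),
    fun a ha => (h'.realArr a ha).trans (h.realArr a ha)⟩

theorem Frame.mono {W W' : List Loc} {s s' : Store} (h : Frame W s s') (hW : W ⊆ W') :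
    Frame W' s s' :=
  ⟨fun x hx => h.natVar x fun hx' => hx (hW hx'), fun a ha => h.natArr a fun ha' => ha (hW ha'),
    fun x hx => h.realVar x fun hx' => hx (hW hx'), fun a ha => h.realArr a fun ha' => ha (hW ha')⟩

theorem Frame.update_natVar (s : Store) (x c : ℕ) :
    Frame [.natVar x] s { s with natVar := Function.update s.natVar x c } :=
  ⟨fun _ hy => Function.update_of_ne (by simpa using hy) _ _, fun _ _ => rfl, fun _ _ => rfl,
    fun _ _ => rfl⟩

theorem Exec.frame {p : Prog} {s s' : Store} {T : ℕ} (h : Exec p s T s') :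
    Frame p.writes s s' := by
  induction h with
  | skip s => exact .refl _ _
  | setNat s x e => exact .update_natVar s x (e.eval s)
  | putNat s a i e =>
    refine ⟨fun _ _ => rfl, fun b hb => Function.update_of_ne ?_ _ _, fun _ _ => rfl,
      fun _ _ => rfl⟩
    simpa [Prog.writes] using hb
  | setReal s x e =>
    refine ⟨fun _ _ => rfl, fun _ _ => rfl, fun y hy => Function.update_of_ne ?_ _ _,
      fun _ _ => rfl⟩
    simpa [Prog.writes] using hy
  | putReal s a i e =>
    refine ⟨fun _ _ => rfl, fun _ _ => rfl, fun _ _ => rfl,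
      fun b hb => Function.update_of_ne ?_ _ _⟩
    simpa [Prog.writes] using hb
  | seq _ _ ih ih' =>
    exact (ih.mono (List.subset_append_left _ _)).trans (ih'.mono (List.subset_append_right _ _))
  | branch_true _ _ ih => exact ih.mono (List.subset_append_left _ _)
  | branch_false _ _ ih => exact ih.mono (List.subset_append_right _ _)
  | loop_true _ _ _ ih ih' => exact ih.trans ih'
  | loop_false _ => exact .refl _ _

/-- Total correctness with running time: `p`, started on `s`, halts, and the number of steps and
the final memory satisfy `Q`. -/
def Runs (p : Prog) (s : Store) (Q : ℕ → Store → Prop) : Prop :=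
  ∃ T s', Exec p s T s' ∧ Q T s'

variable {p q : Prog} {s : Store} {Q R : ℕ → Store → Prop}

theorem Runs.mono (h : Runs p s Q) (hQ : ∀ T s', Frame p.writes s s' → Q T s' → R T s') :
    Runs p s R := by
  obtain ⟨T, s', he, hq⟩ := h
  exact ⟨T, s', he, hQ T s' he.frame hq⟩

@[simp]
theorem runs_skip : Runs .skip s Q ↔ Q 1 s :=
  ⟨fun ⟨_, _, he, hq⟩ => by cases he; exact hq, fun h => ⟨_, _, .skip s, h⟩⟩

@[simp]
theorem runs_setNat {x : ℕ} {e : NExp} : Runs (.setNat x e) s Q ↔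
    Q (e.cost + 1) { s with natVar := Function.update s.natVar x (e.eval s) } :=
  ⟨fun ⟨_, _, he, hq⟩ => by cases he; exact hq, fun h => ⟨_, _, .setNat s x e, h⟩⟩

@[simp]
theorem runs_putNat {a : ℕ} {i e : NExp} : Runs (.putNat a i e) s Q ↔
    Q (i.cost + e.cost + 1) { s with
      natArr := Function.update s.natArr a (Function.update (s.natArr a) (i.eval s) (e.eval s)) } :=
  ⟨fun ⟨_, _, he, hq⟩ => by cases he; exact hq, fun h => ⟨_, _, .putNat s a i e, h⟩⟩

@[simp]
theorem runs_setReal {x : ℕ} {e : RExp} : Runs (.setReal x e) s Q ↔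
    Q (e.cost + 1) { s with realVar := Function.update s.realVar x (e.eval s) } :=
  ⟨fun ⟨_, _, he, hq⟩ => by cases he; exact hq, fun h => ⟨_, _, .setReal s x e, h⟩⟩

@[simp]
theorem runs_putReal {a : ℕ} {i : NExp} {e : RExp} : Runs (.putReal a i e) s Q ↔
    Q (i.cost + e.cost + 1) { s with
      realArr := Function.update s.realArr a
        (Function.update (s.realArr a) (i.eval s) (e.eval s)) } :=
  ⟨fun ⟨_, _, he, hq⟩ => by cases he; exact hq, fun h => ⟨_, _, .putReal s a i e, h⟩⟩

@[simp]
theorem runs_seq : Runs (p ⨾ q) s Q ↔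
    Runs p s fun T s' => Runs q s' fun T' s'' => Q (T + T') s'' := by
  constructor
  · rintro ⟨_, _, he, hq⟩
    cases he with
    | seq h h' => exact ⟨_, _, h, _, _, h', hq⟩
  · rintro ⟨_, _, he, _, _, he', hq⟩
    exact ⟨_, _, .seq he he', hq⟩

@[simp]
theorem runs_branch {b : BExp} : Runs (.branch b p q) s Q ↔
    (b.Holds s → Runs p s fun T s' => Q (b.cost + 1 + T) s') ∧
    (¬ b.Holds s → Runs q s fun T s' => Q (b.cost + 1 + T) s') := by
  refine ⟨fun ⟨_, _, he, hq⟩ => ?_, fun ⟨h, h'⟩ => ?_⟩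
  · cases he with
    | branch_true hb h => exact ⟨fun _ => ⟨_, _, h, hq⟩, fun hb' => absurd hb hb'⟩
    | branch_false hb h => exact ⟨fun hb' => absurd hb' hb, fun _ => ⟨_, _, h, hq⟩⟩
  · by_cases hb : b.Holds s
    · obtain ⟨T, s', he, hq⟩ := h hb
      exact ⟨_, _, .branch_true hb he, hq⟩
    · obtain ⟨T, s', he, hq⟩ := h' hb
      exact ⟨_, _, .branch_false hb he, hq⟩

theorem runs_loop {b : BExp} : Runs (.loop b p) s Q ↔
    (b.Holds s → Runs p s fun T s' =>
      Runs (.loop b p) s' fun T' s'' => Q (b.cost + 1 + T + T') s'') ∧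
    (¬ b.Holds s → Q (b.cost + 1) s) := by
  refine ⟨fun ⟨_, _, he, hq⟩ => ?_, fun ⟨h, h'⟩ => ?_⟩
  · cases he with
    | loop_true hb h h' => exact ⟨fun _ => ⟨_, _, h, _, _, h', hq⟩, fun hb' => absurd hb hb'⟩
    | loop_false hb => exact ⟨fun hb' => absurd hb' hb, fun _ => hq⟩
  · by_cases hb : b.Holds s
    · obtain ⟨T, s', he, T', s'', he', hq⟩ := h hb
      exact ⟨_, _, .loop_true hb he he', hq⟩
    · exact ⟨_, _, .loop_false hb, h' hb⟩

/-- Loop rule: the invariant `I k` carries a potential `k`, which pays for all further steps. -/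
theorem Runs.loop {b : BExp} (I : ℕ → Store → Prop) {k : ℕ} (h0 : I k s)
    (step : ∀ k s', Frame p.writes s s' → I k s' → b.Holds s' →
      Runs p s' fun T s'' => ∃ k', I k' s'' ∧ T + (b.cost + 1) + k' ≤ k) :
    Runs (.loop b p) s fun T s' => T ≤ k + (b.cost + 1) ∧ (∃ k' ≤ k, I k' s') ∧
      ¬ b.Holds s' := by
  suffices ∀ k s', Frame p.writes s s' → I k s' → Runs (.loop b p) s' fun T s'' =>
      T ≤ k + (b.cost + 1) ∧ (∃ k' ≤ k, I k' s'') ∧ ¬ b.Holds s'' from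
    this k s (.refl _ _) h0
  intro k
  induction k using Nat.strong_induction_on with
  | _ k ih =>
    intro s' hs' hI
    refine runs_loop.2 ⟨fun hb => (step k s' hs' hI hb).mono ?_,
      fun hb => ⟨by omega, ⟨k, le_rfl, hI⟩, hb⟩⟩
    rintro T s'' hs'' ⟨k', hI', hk⟩
    refine (ih k' (by omega) s'' (hs'.trans hs'') hI').mono ?_
    rintro T' s₃ - ⟨hT', ⟨k'', hk'', hI''⟩, hn⟩
    exact ⟨by omega, ⟨k'', by omega, hI''⟩, hn⟩

/-- Run `p` for the values `0, …, N - 1` of register `x`, where `N` is the value of register `y`. -/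
def Prog.forTo (x y : ℕ) (p : Prog) : Prog :=
  .setNat x (.lit 0) ⨾
  .loop (.neg (.natLe (.var y) (.var x))) (p ⨾ .setNat x (.plus (.var x) (.lit 1)))

theorem Runs.forTo {x y N : ℕ} (I : ℕ → Store → Prop) (c : ℕ)
    (hN : s.natVar y = N) (hxy : x ≠ y) (hx : .natVar x ∉ p.writes) (hy : .natVar y ∉ p.writes)
    (h0 : I 0 { s with natVar := Function.update s.natVar x 0 })
    (step : ∀ i s', i < N → Frame (Prog.forTo x y p).writes s s' → s'.natVar x = i → I i s' →
      Runs p s' fun T s'' => T ≤ c ∧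
        I (i + 1) { s'' with natVar := Function.update s''.natVar x (i + 1) }) :
    Runs (Prog.forTo x y p) s fun T s' => T ≤ N * (c + 9) + 7 ∧ I N s' := by
  let body := p ⨾ .setNat x (.plus (.var x) (.lit 1))
  let s₀ : Store := { s with natVar := Function.update s.natVar x 0 }
  have frame_of_body {s'} (h : Frame body.writes s₀ s') : Frame (Prog.forTo x y p).writes s s' :=
    ((Exec.setNat s x (.lit 0)).frame.mono (List.subset_append_left _ _)).trans
      (h.mono (List.subset_append_right _ _))
  have bound_eq {s'} (h : Frame body.writes s₀ s') : s'.natVar y = N :=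
    ((frame_of_body h).natVar y (by simp [Prog.forTo, Prog.writes, hy, hxy.symm])).trans hN
  rw [Prog.forTo, runs_seq, runs_setNat]
  refine (Runs.loop (p := body) (k := N * (c + 9))
    (fun k s' => ∃ i ≤ N, k = (N - i) * (c + 9) ∧ s'.natVar x = i ∧ I i s')
    ⟨0, Nat.zero_le _, by simp, by simp, h0⟩ ?_).mono ?_
  · rintro k s' hs' ⟨i, -, rfl, hxi, hI⟩ hb
    have hiN : i < N := by simpa [hxi, bound_eq hs'] using hb
    refine runs_seq.2 ((step i s' hiN (frame_of_body hs') hxi hI).mono ?_)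
    rintro T s'' hfr' ⟨hT, hI'⟩
    have hxi' : s''.natVar x = i := (hfr'.natVar x hx).trans hxi
    have hpay : (N - i) * (c + 9) = (c + 9) + (N - (i + 1)) * (c + 9) := by
      rw [show N - i = N - (i + 1) + 1 by omega]
      ring
    simp only [runs_setNat, NExp.eval, hxi']
    refine ⟨_, ⟨i + 1, hiN, rfl, by simp, hI'⟩, ?_⟩
    simp only [BExp.cost, NExp.cost]
    omega
  · rintro T s' hs' ⟨hT, ⟨k', -, i, hi, -, hxi, hI⟩, hb⟩
    obtain rfl : i = N := hi.antisymm (by simpa [hxi, bound_eq hs'] using hb)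
    exact ⟨by simp only [BExp.cost, NExp.cost] at hT ⊢; omega, hI⟩

end ProgramLogic

section PackingBound

variable {V : Type*}

theorem IsRootedAcyclic.adj {G : SimpleGraph V} {r u v : V} {D : Digraph V}
    (hD : IsRootedAcyclic G r D) (h : D.Adj u v) : G.Adj u v :=
  (hD.orientation.adj_iff u v).2 (.inl h)

theorem zero_mem_packingValues {D : Digraph V} {w : Sym2 V → ℝ} (r : V)
    (hw : ∀ u v, D.Adj u v → 0 ≤ w s(u, v)) : 0 ∈ packingValues D w r :=
  ⟨0, Fin.elim0, Fin.elim0, ⟨fun j => j.elim0, fun j => j.elim0, by simpa using hw⟩, by simp⟩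

variable [Fintype V]

theorem inWeight_nonneg {D : Digraph V} {w : Sym2 V → ℝ} (hw : ∀ u v, D.Adj u v → 0 ≤ w s(u, v))
    (v : V) : 0 ≤ inWeight D w v :=
  Finset.sum_nonneg fun u _ => by split_ifs with h; exacts [hw u v h, le_rfl]

theorem le_inWeight_of_mem_packingValues {D : Digraph V} {w : Sym2 V → ℝ} {r v : V} {x : ℝ}
    (hx : x ∈ packingValues D w r) (hv : v ≠ r) : x ≤ inWeight D w v := by
  classical
  obtain ⟨t, lam, A, hP, rfl⟩ := hx
  have lam_eq (j : Fin t) : lam j = ∑ u, if (A j).Adj u v then lam j else 0 := by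
    obtain ⟨u, hu, huu⟩ := (hP.arborescence j).parent v hv
    rw [Finset.sum_eq_single u (fun b _ hb => if_neg fun h => hb (huu b h)) (by simp), if_pos hu]
  rw [Finset.sum_congr rfl fun j _ => lam_eq j, Finset.sum_comm, inWeight]
  refine Finset.sum_le_sum fun u _ => ?_
  split_ifs with h
  · convert hP.capacity u v h
  · exact (Finset.sum_eq_zero fun j _ =>
      if_neg fun hA => h ((hP.arborescence j).le u v hA)).le

/-- Some `r`-acyclic orientation of `G` gives all vertices other than `r` weighted indegree at
least `x`. -/
def IsFeasible (G : SimpleGraph V) (w : Sym2 V → ℝ) (r : V) (x : ℝ) : Prop :=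
  ∃ D, IsRootedAcyclic G r D ∧ ∀ v, v ≠ r → x ≤ inWeight D w v

variable {G : SimpleGraph V} {w : Sym2 V → ℝ} {r : V} {D : Digraph V} {K : ℝ}

theorem isGreatest_packingValues (hmin : IsLeast {x | ∃ v, v ≠ r ∧ x = inWeight D w v} K)
    (hK : K ∈ packingValues D w r) : IsGreatest (packingValues D w r) K := by
  obtain ⟨⟨v, hv, rfl⟩, -⟩ := hmin
  exact ⟨hK, fun x hx => le_inWeight_of_mem_packingValues hx hv⟩

theorem isGreatest_rootedValues (hw : ∀ e ∈ G.edgeSet, 0 ≤ w e) (hD : IsRootedAcyclic G r D)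
    (hK : IsGreatest (packingValues D w r) K) (hopt : ∀ x, IsFeasible G w r x → x ≤ K) :
    IsGreatest (rootedValues G w r) K := by
  refine ⟨⟨D, hD, hK.csSup_eq.symm⟩, ?_⟩
  rintro _ ⟨D', hD', rfl⟩
  exact csSup_le ⟨0, zero_mem_packingValues r fun u v h => hw _ (hD'.adj h)⟩ fun x hx =>
    hopt x ⟨D', hD', fun v hv => le_inWeight_of_mem_packingValues hx hv⟩

end PackingBound

section GreedyOrder

variable {V : Type*} {G : SimpleGraph V} {w : Sym2 V → ℝ} {r : V} {l : List V} {x v : V}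

/-- The orientation of the edges of `G` from smaller to larger values of `f`. -/
def orientBy (G : SimpleGraph V) (f : V → ℕ) : Digraph V where
  Adj u v := G.Adj u v ∧ f u < f v

theorem isRootedAcyclic_orientBy {f : V → ℕ} (hinj : Function.Injective f)
    (hpar : ∀ v, v ≠ r → ∃ u, (orientBy G f).Adj u v) (hr : ∀ v, f r ≤ f v) :
    IsRootedAcyclic G r (orientBy G f) := by
  refine ⟨⟨fun u v => ⟨fun h => ?_, ?_⟩, fun u v h h' => lt_asymm h.2 h'.2⟩, fun v h => ?_,
    fun v => ⟨fun h => ?_, ?_⟩⟩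
  · exact (lt_or_gt_of_ne (hinj.ne h.ne)).imp (⟨h, ·⟩) (⟨h.symm, ·⟩)
  · rintro (h | h)
    exacts [h.1, h.1.symm]
  · have lt_of_transGen {u v} (h : Relation.TransGen (orientBy G f).Adj u v) : f u < f v := by
      induction h with
      | single h => exact h.2
      | tail _ h ih => exact ih.trans h.2
    exact lt_irrefl _ (lt_of_transGen h)
  · by_contra hv
    exact (hpar v hv).elim h
  · rintro rfl u h
    exact h.2.not_ge (hr u)

/-- The vertices that may follow the vertices of `l` in an order of the vertices of `G` that grows
from the root `r`. -/
def frontier (G : SimpleGraph V) (r : V) (l : List V) : Set V :=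
  {v | v ∉ l ∧ (v = r ∨ ∃ u ∈ l, G.Adj u v)}

theorem frontier_nil : frontier G r [] = {r} := by
  ext; simp [frontier]

theorem mem_frontier_cons :
    v ∈ frontier G r (x :: l) ↔ v ≠ x ∧ (v ∈ frontier G r l ∨ v ∉ l ∧ G.Adj x v) := by
  simp only [frontier, Set.mem_ofPred_eq, List.mem_cons, exists_eq_or_imp]
  grind

theorem mem_of_frontier_eq_empty (h : frontier G r l = ∅) (hG : G.Connected) (v : V) : v ∈ l := by
  have notMem (u) : u ∉ frontier G r l := h ▸ Set.notMem_empty u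
  have hr : r ∈ l := by
    by_contra hr
    exact notMem r ⟨hr, .inl rfl⟩
  by_contra hv
  obtain ⟨p⟩ := hG.preconnected r v
  obtain ⟨d, -, hd, hd'⟩ := p.exists_boundary_dart {u | u ∈ l} hr hv
  exact notMem d.snd ⟨hd', .inr ⟨d.fst, hd, d.adj⟩⟩

variable [DecidableEq V]

open Classical in
/-- The weight of the edges from `v` to the vertices that precede `v` in the order `l`, or to all
vertices of `l` if `v` does not occur in `l`. (The head of `l` is its last vertex.) -/
noncomputable def backWeight (G : SimpleGraph V) (w : Sym2 V → ℝ) : List V → V → ℝ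
  | [], _ => 0
  | x :: l, v => backWeight G w l v + if v ∉ x :: l ∧ G.Adj x v then w s(x, v) else 0

/-- An order of some vertices of `G`, written with the last vertex at the head of the list, in which
each next vertex is one of the frontier with the largest total weight of edges from its
predecessors. -/
inductive GreedyOrder (G : SimpleGraph V) (w : Sym2 V → ℝ) (r : V) : List V → Prop
  | nil : GreedyOrder G w r []
  | cons {l : List V} {x : V} (hl : GreedyOrder G w r l) (hx : x ∈ frontier G r l)
      (hmax : ∀ v ∈ frontier G r l, backWeight G w l v ≤ backWeight G w l x) :
      GreedyOrder G w r (x :: l)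

namespace GreedyOrder

theorem nodup (h : GreedyOrder G w r l) : l.Nodup := by
  induction h with
  | nil => exact .nil
  | cons _ hx _ ih => exact List.nodup_cons.2 ⟨hx.1, ih⟩

theorem root_mem (h : GreedyOrder G w r l) (hl : l ≠ []) : r ∈ l := by
  induction h with
  | nil => exact absurd rfl hl
  | @cons l x _ hx _ ih =>
    rcases eq_or_ne l [] with rfl | hl
    · rw [frontier_nil] at hx
      exact List.mem_singleton.2 hx.symm
    · exact List.mem_cons_of_mem _ (ih hl)

theorem exists_adj_of_mem_frontier (h : GreedyOrder G w r l) (hl : l ≠ [])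
    (hx : x ∈ frontier G r l) : ∃ u ∈ l, G.Adj u x :=
  hx.2.resolve_left fun hxr => hx.1 (hxr ▸ h.root_mem hl)

end GreedyOrder

/-- The position of `v` in `l`, counted from `1` at the end of the list, or `0` if `v` does not
occur in `l`. -/
def rank : List V → V → ℕ
  | [], _ => 0
  | x :: l, v => if v = x then l.length + 1 else rank l v

theorem rank_pos_iff : 0 < rank l v ↔ v ∈ l := by
  induction l with
  | nil => simp [rank]
  | cons x l ih => by_cases h : v = x <;> simp [rank, h, ih]

theorem rank_le_length (l : List V) (v : V) : rank l v ≤ l.length := by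
  induction l with
  | nil => simp [rank]
  | cons x l ih =>
    rw [rank, List.length_cons]
    split_ifs <;> omega

theorem eq_of_rank_eq {u : V} (hu : u ∈ l) (h : rank l u = rank l v) : u = v := by
  induction l with
  | nil => simp at hu
  | cons x l ih =>
    have := rank_le_length l u
    have := rank_le_length l v
    simp only [rank] at h
    split_ifs at h with hux hvx hvx
    · exact hux.trans hvx.symm
    · omega
    · omega
    · exact ih ((List.mem_cons.1 hu).resolve_left hux) h

open Classical in
theorem backWeight_eq_sum [Fintype V] (hl : l.Nodup) (v : V) : backWeight G w l v =
    ∑ u, if G.Adj u v ∧ u ∈ l ∧ (v ∈ l → rank l u < rank l v) then w s(u, v) else 0 := by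
  induction l with
  | nil => simp [backWeight]
  | cons x l ih =>
    obtain ⟨hx, hl⟩ := List.nodup_cons.1 hl
    have ite_eq : (if v ∉ x :: l ∧ G.Adj x v then w s(x, v) else 0) =
        ∑ u, if u = x then (if v ∉ x :: l ∧ G.Adj x v then w s(u, v) else 0) else 0 := by simp
    rw [backWeight, ih hl, ite_eq, ← Finset.sum_add_distrib]
    refine Finset.sum_congr rfl fun u _ => ?_
    have := rank_le_length l u
    have := rank_le_length l v
    by_cases hux : u = x
    · subst hux
      by_cases hvx : v = u
      · simp [hvx]
      · have : ¬ l.length + 1 < rank l v := by omega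
        simp [rank, hx, hvx, this, and_comm]
    · by_cases hvx : v = x
      · subst hvx
        have : rank l u < l.length + 1 := by omega
        simp [rank, hux, hx, this]
      · simp [rank, hux, hvx]

namespace GreedyOrder

theorem rank_root_le (h : GreedyOrder G w r l) (hv : v ∈ l) : rank l r ≤ rank l v := by
  induction h with
  | nil => simp at hv
  | @cons l x h hx _ ih =>
    rcases eq_or_ne l [] with rfl | hl
    · rw [frontier_nil] at hx
      obtain rfl : x = r := hx
      simp_all
    · have hrx : r ≠ x := fun hrx => hx.1 (hrx ▸ h.root_mem hl)
      by_cases hvx : v = x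
      · simpa [rank, hvx, hrx] using (rank_le_length l r).trans (Nat.le_succ _)
      · simpa [rank, hvx, hrx] using ih ((List.mem_cons.1 hv).resolve_left hvx)

theorem exists_adj_rank_lt (h : GreedyOrder G w r l) (hv : v ∈ l) (hvr : v ≠ r) :
    ∃ u ∈ l, G.Adj u v ∧ rank l u < rank l v := by
  induction h with
  | nil => simp at hv
  | @cons l x _ hx _ ih =>
    have ne_of_mem {u} (hu : u ∈ l) : u ≠ x := fun hux => hx.1 (hux ▸ hu)
    by_cases hvx : v = x
    · subst hvx
      obtain ⟨u, hu, huv⟩ := hx.2.resolve_left hvr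
      refine ⟨u, List.mem_cons_of_mem _ hu, huv, ?_⟩
      simpa [rank, ne_of_mem hu] using Nat.lt_succ_of_le (rank_le_length l u)
    · obtain ⟨u, hu, huv, hlt⟩ := ih ((List.mem_cons.1 hv).resolve_left hvx)
      exact ⟨u, List.mem_cons_of_mem _ hu, huv, by simpa [rank, ne_of_mem hu, hvx] using hlt⟩

end GreedyOrder

open Classical in
theorem exists_mem_frontier_le_backWeight [Fintype V] (hl : l.Nodup) (hr : r ∈ l) (hv : v ∉ l)
    (hw : ∀ e ∈ G.edgeSet, 0 ≤ w e) {a : ℝ} (ha : IsFeasible G w r a) :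
    ∃ u ∈ frontier G r l, a ≤ backWeight G w l u := by
  obtain ⟨D, hD, haD⟩ := ha
  have : Std.Irrefl (Relation.TransGen D.Adj) := ⟨hD.acyclic⟩
  obtain ⟨u, hu, hmin⟩ :=
    (Finite.wellFounded_of_trans_of_irrefl (Relation.TransGen D.Adj)).has_min {u | u ∉ l} ⟨v, hv⟩
  have mem_of_adj {y} (hy : D.Adj y u) : y ∈ l := not_not.1 fun hyl => hmin y hyl (.single hy)
  have hur : u ≠ r := fun hur => hu (hur ▸ hr)
  obtain ⟨y, hy⟩ : ∃ y, D.Adj y u := by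
    by_contra! hy
    exact hur ((hD.source_iff u).1 hy)
  refine ⟨u, ⟨hu, .inr ⟨y, mem_of_adj hy, hD.adj hy⟩⟩, (haD u hur).trans ?_⟩
  rw [backWeight_eq_sum hl, inWeight]
  refine Finset.sum_le_sum fun y _ => ?_
  by_cases hy : D.Adj y u
  · rw [if_pos hy, if_pos ⟨hD.adj hy, mem_of_adj hy, fun h => absurd h hu⟩]
  · rw [if_neg hy]
    split_ifs with h
    exacts [hw _ h.1, le_rfl]

namespace GreedyOrder

theorem le_backWeight [Fintype V] (h : GreedyOrder G w r l) (hw : ∀ e ∈ G.edgeSet, 0 ≤ w e)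
    {a : ℝ} (ha : IsFeasible G w r a) (hv : v ∈ l) (hvr : v ≠ r) : a ≤ backWeight G w l v := by
  induction h with
  | nil => simp at hv
  | @cons l x h hx hmax ih =>
    have : ¬ (v ∉ x :: l ∧ G.Adj x v) := fun h => h.1 hv
    rw [backWeight, if_neg this, add_zero]
    rcases List.mem_cons.1 hv with rfl | hv
    · have hl : l ≠ [] := by
        rintro rfl
        rw [frontier_nil] at hx
        exact hvr hx
      obtain ⟨u, hu, hau⟩ :=
        exists_mem_frontier_le_backWeight h.nodup (h.root_mem hl) hx.1 hw ha
      exact hau.trans (hmax u hu)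
    · exact ih hv

theorem isRootedAcyclic_orientBy (h : GreedyOrder G w r l) (hl : ∀ v, v ∈ l) :
    IsRootedAcyclic G r (orientBy G (rank l)) := by
  refine Broadcast.isRootedAcyclic_orientBy (fun u v => eq_of_rank_eq (hl u)) (fun v hv => ?_)
    fun v => h.rank_root_le (hl v)
  obtain ⟨u, -, huv⟩ := h.exists_adj_rank_lt (hl v) hv
  exact ⟨u, huv⟩

open Classical in
theorem inWeight_orientBy [Fintype V] (h : GreedyOrder G w r l) (hl : ∀ v, v ∈ l) (v : V) :
    inWeight (orientBy G (rank l)) w v = backWeight G w l v := by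
  rw [backWeight_eq_sum h.nodup, inWeight]
  exact Finset.sum_congr rfl fun u _ => if_congr (by simp [orientBy, hl]) rfl rfl

open Classical in
theorem ncard_frontier_add_le [Fintype V] (h : GreedyOrder G w r l) :
    (frontier G r l).ncard + 2 * l.length ≤ 2 + ∑ v ∈ l.toFinset, G.degree v := by
  induction h with
  | nil => simp [frontier_nil]
  | @cons l x h hx _ ih =>
    have split : frontier G r (x :: l) ⊆ frontier G r l \ {x} ∪ (G.neighborSet x \ {v | v ∈ l}) :=
      fun v hv => (mem_frontier_cons.1 hv).2.imp (⟨·, (mem_frontier_cons.1 hv).1⟩) And.symm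
    have card_le := (Set.ncard_le_ncard split).trans (Set.ncard_union_le _ _)
    have card_diff : (frontier G r l \ {x}).ncard + 1 = (frontier G r l).ncard :=
      Set.ncard_sdiff_singleton_add_one hx
    have card_neighbors : (G.neighborSet x).ncard = G.degree x := by
      rw [Set.ncard_eq_toFinset_card', ← G.neighborFinset_def, G.card_neighborFinset_eq_degree]
    have hxl : x ∉ l.toFinset := by simpa using hx.1
    rw [List.toFinset_cons, Finset.sum_insert hxl, List.length_cons]
    rcases eq_or_ne l [] with rfl | hl
    · have : (frontier G r []).ncard = 1 := by rw [frontier_nil, Set.ncard_singleton]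
      have : (G.neighborSet x \ {v | v ∈ []}).ncard ≤ (G.neighborSet x).ncard :=
        Set.ncard_le_ncard Set.sdiff_subset
      simp only [List.toFinset_nil, Finset.sum_empty, List.length_nil]
      omega
    · obtain ⟨u, hu, hux⟩ := h.exists_adj_of_mem_frontier hl hx
      have : (G.neighborSet x \ {v | v ∈ l}).ncard < (G.neighborSet x).ncard :=
        Set.ncard_lt_ncard ⟨Set.sdiff_subset, fun hsub => (hsub hux.symm).2 hu⟩
      omega

theorem ncard_frontier_le [Finite V] (h : GreedyOrder G w r l)
    (hdeg : ∀ v, (G.neighborSet v).Nontrivial) :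
    (frontier G r l).ncard ≤ 2 * (G.edgeSet.ncard - Nat.card V + 1) := by
  classical
  have := Fintype.ofFinite V
  have two_le_degree (v : V) : 2 ≤ G.degree v := by
    rw [← G.card_neighborFinset_eq_degree, G.neighborFinset_def, ← Set.ncard_eq_toFinset_card']
    exact (Set.one_lt_ncard_iff_nontrivial).2 (hdeg v)
  have sum_degree := G.sum_degrees_eq_twice_card_edges
  rw [← Set.ncard_coe_finset, G.coe_edgeFinset, ← Finset.sum_add_sum_compl l.toFinset] at sum_degree
  have compl_le :=
    Finset.card_nsmul_le_sum l.toFinsetᶜ (fun v => G.degree v) 2 fun v _ => two_le_degree v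
  have := h.ncard_frontier_add_le
  have card_add := Finset.card_add_card_compl l.toFinset
  rw [List.toFinset_card_of_nodup h.nodup] at card_add
  rw [Nat.card_eq_fintype_card]
  simp only [smul_eq_mul] at compl_le
  omega

end GreedyOrder

end GreedyOrder

section Memory

namespace NatReg
abbrev size : ℕ := 0
abbrev edges : ℕ := 1
abbrev root : ℕ := 2
abbrev trees : ℕ := 3
abbrev index : ℕ := 4
abbrev cells : ℕ := 5
abbrev queueSize : ℕ := 6
abbrev placed : ℕ := 7
abbrev position : ℕ := 8
abbrev vertex : ℕ := 9
abbrev pointer : ℕ := 10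
abbrev offset : ℕ := 11
abbrev bestRoot : ℕ := 12
abbrev cell : ℕ := 13
abbrev candidate : ℕ := 14
end NatReg

namespace NatArr
abbrev src : ℕ := 0
abbrev dst : ℕ := 1
abbrev flag : ℕ := 2
abbrev tree : ℕ := 3
abbrev target : ℕ := 4
abbrev next : ℕ := 5
abbrev first : ℕ := 6
abbrev rank : ℕ := 7
abbrev seen : ℕ := 8
abbrev queue : ℕ := 9
abbrev tail : ℕ := 10
abbrev head : ℕ := 11
abbrev entering : ℕ := 12
end NatArr

namespace RealReg
abbrev value : ℕ := 0
abbrev remaining : ℕ := 1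
abbrev increment : ℕ := 2
abbrev best : ℕ := 3
end RealReg

namespace RealArr
abbrev weight : ℕ := 0
abbrev coeff : ℕ := 1
abbrev cellWeight : ℕ := 2
abbrev reach : ℕ := 3
abbrev capacity : ℕ := 4
end RealArr

variable {n m : ℕ} {G : SimpleGraph (Fin n)} {w : Sym2 (Fin n) → ℝ} {r : Fin n}
  {L : EdgeList G m} {s s' : Store}

theorem EdgeList.ncard_edgeSet (L : EdgeList G m) : G.edgeSet.ncard = m := by
  rw [← L.range_eq, ← Set.image_univ, Set.ncard_image_of_injective _ L.injective, Set.ncard_univ,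
    Nat.card_eq_fintype_card, Fintype.card_fin]

theorem EdgeList.adj_iff (L : EdgeList G m) {u v : Fin n} :
    G.Adj u v ↔ ∃ i, s(L.src i, L.dst i) = s(u, v) := by
  rw [← SimpleGraph.mem_edgeSet, ← L.range_eq, Set.mem_range]

theorem EdgeList.adj (L : EdgeList G m) (i : Fin m) : G.Adj (L.src i) (L.dst i) :=
  L.adj_iff.2 ⟨i, rfl⟩

/-- The memory holds the input `(G, w, r)`. -/
structure HasInput (L : EdgeList G m) (w : Sym2 (Fin n) → ℝ) (r : Fin n) (s : Store) :
    Prop where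
  size : s.natVar NatReg.size = n
  edges : s.natVar NatReg.edges = m
  root : s.natVar NatReg.root = r
  src : ∀ i : Fin m, s.natArr NatArr.src i = L.src i
  dst : ∀ i : Fin m, s.natArr NatArr.dst i = L.dst i
  weight : ∀ i : Fin m, s.realArr RealArr.weight i = w s(L.src i, L.dst i)

theorem hasInput_inputStore (L : EdgeList G m) (w : Sym2 (Fin n) → ℝ) (r : Fin n) :
    HasInput L w r (inputStore L w r) := by
  constructor <;> simp [inputStore]

/-- The registers and arrays of the input. -/
def inputLocs : List Loc :=
  [.natVar NatReg.size, .natVar NatReg.edges, .natVar NatReg.root, .natArr NatArr.src,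
    .natArr NatArr.dst, .realArr RealArr.weight]

theorem HasInput.of_frame {W : List Loc} (h : HasInput L w r s) (hs : Frame W s s')
    (hW : ∀ x ∈ inputLocs, x ∉ W) : HasInput L w r s' where
  size := (hs.natVar _ (hW _ (by decide))).trans h.size
  edges := (hs.natVar _ (hW _ (by decide))).trans h.edges
  root := (hs.natVar _ (hW _ (by decide))).trans h.root
  src i := (congrFun (hs.natArr _ (hW _ (by decide))) i).trans (h.src i)
  dst i := (congrFun (hs.natArr _ (hW _ (by decide))) i).trans (h.dst i)
  weight i := (congrFun (hs.realArr _ (hW _ (by decide))) i).trans (h.weight i)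

end Memory

section LinkedLists

variable {n m : ℕ} {G : SimpleGraph (Fin n)} {w : Sym2 (Fin n) → ℝ} {r u v : Fin n}
  {L : EdgeList G m} {s s' : Store} {R : Fin n → Fin n → Prop}

/-- The linked list that starts at the given pointer runs through the given vertices `v`, with the
weights of the edges `s(u, v)`. The pointer to a cell is one more than its index, so that `0` is the
null pointer. -/
def IsLinkedList (w : Sym2 (Fin n) → ℝ) (u : Fin n) (s : Store) : ℕ → List (Fin n) → Prop
  | p, [] => p = 0
  | p, v :: vs => ∃ e < s.natVar NatReg.cells, p = e + 1 ∧ s.natArr NatArr.target e = v ∧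
      s.realArr RealArr.cellWeight e = w s(u, v) ∧
      IsLinkedList w u s (s.natArr NatArr.next e) vs

theorem IsLinkedList.mono {p : ℕ} {vs : List (Fin n)} (h : IsLinkedList w u s p vs)
    (hcells : s.natVar NatReg.cells ≤ s'.natVar NatReg.cells)
    (heq : ∀ e < s.natVar NatReg.cells, s'.natArr NatArr.target e = s.natArr NatArr.target e ∧
      s'.realArr RealArr.cellWeight e = s.realArr RealArr.cellWeight e ∧
      s'.natArr NatArr.next e = s.natArr NatArr.next e) : IsLinkedList w u s' p vs := by
  induction vs generalizing p with
  | nil => exact h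
  | cons v vs ih =>
    obtain ⟨e, he, rfl, htarget, hweight, hnext⟩ := h
    obtain ⟨htarget', hweight', hnext'⟩ := heq e he
    exact ⟨e, he.trans_le hcells, rfl, htarget'.trans htarget, hweight'.trans hweight,
      by rw [hnext']; exact ih hnext⟩

/-- The registers and arrays that hold the linked lists. -/
def listLocs : List Loc :=
  [.natVar NatReg.cells, .natArr NatArr.target, .realArr RealArr.cellWeight, .natArr NatArr.next,
    .natArr NatArr.first]

theorem IsLinkedList.of_frame {W : List Loc} {p : ℕ} {vs : List (Fin n)}
    (h : IsLinkedList w u s p vs) (hs : Frame W s s') (hW : ∀ x ∈ listLocs, x ∉ W) :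
    IsLinkedList w u s' p vs :=
  h.mono (hs.natVar _ (hW _ (by decide))).ge fun e _ =>
    ⟨congrFun (hs.natArr _ (hW _ (by decide))) e, congrFun (hs.realArr _ (hW _ (by decide))) e,
      congrFun (hs.natArr _ (hW _ (by decide))) e⟩

/-- The memory holds, for each vertex `u`, a linked list of the vertices `v` with `R u v`. -/
def HasLists (R : Fin n → Fin n → Prop) (w : Sym2 (Fin n) → ℝ) (s : Store) : Prop :=
  ∀ u : Fin n, ∃ vs : List (Fin n), vs.Nodup ∧ (∀ v, v ∈ vs ↔ R u v) ∧
    IsLinkedList w u s (s.natArr NatArr.first u) vs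

theorem HasLists.of_frame {W : List Loc} (h : HasLists R w s) (hs : Frame W s s')
    (hW : ∀ x ∈ listLocs, x ∉ W) : HasLists R w s' := by
  intro u
  obtain ⟨vs, hnodup, hmem, hvs⟩ := h u
  refine ⟨vs, hnodup, hmem, ?_⟩
  rw [hs.natArr _ (hW _ (by decide))]
  exact hvs.of_frame hs hW

/-- Empty the linked lists and forget the vertices that have been seen or ranked. -/
def clearProg : Prog :=
  .setNat NatReg.cells (.lit 0) ⨾
  .forTo NatReg.index NatReg.size
    (.putNat NatArr.first (.var NatReg.index) (.lit 0) ⨾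
    .putNat NatArr.rank (.var NatReg.index) (.lit 0) ⨾
    .putNat NatArr.seen (.var NatReg.index) (.lit 0) ⨾
    .putReal RealArr.reach (.var NatReg.index) .zero)

theorem clearProg_runs (h : s.natVar NatReg.size = n) :
    Runs clearProg s fun T s' => T ≤ 30 * n + 30 ∧ s'.natVar NatReg.cells = 0 ∧
      ∀ v < n, s'.natArr NatArr.first v = 0 ∧ s'.natArr NatArr.rank v = 0 ∧
        s'.natArr NatArr.seen v = 0 ∧ s'.realArr RealArr.reach v = 0 := by
  simp only [clearProg, runs_seq, runs_setNat]
  refine (Runs.forTo (N := n) (fun i s' => ∀ v < i, s'.natArr NatArr.first v = 0 ∧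
    s'.natArr NatArr.rank v = 0 ∧ s'.natArr NatArr.seen v = 0 ∧ s'.realArr RealArr.reach v = 0) 12
    (by simpa using h) (by decide) (by decide) (by decide) (by simp) ?_).mono ?_
  · intro i s' _ _ hx hI
    simp only [runs_seq, runs_putNat, runs_putReal, NExp.eval, NExp.cost, RExp.eval, RExp.cost, hx]
    refine ⟨by norm_num, fun v hv => ?_⟩
    rcases Nat.lt_succ_iff_lt_or_eq.1 hv with hv | rfl
    · simpa [hv.ne] using hI v hv
    · simp
  · rintro T s' hs' ⟨hT, hI⟩
    exact ⟨by simp only [NExp.cost]; omega, by simp [hs'.natVar NatReg.cells (by decide)], hI⟩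

theorem HasLists.insert (h : HasLists R w s) (huv : ¬ R u v)
    (hcells : s'.natVar NatReg.cells = s.natVar NatReg.cells + 1)
    (htarget : s'.natArr NatArr.target =
      Function.update (s.natArr NatArr.target) (s.natVar NatReg.cells) v)
    (hweight : s'.realArr RealArr.cellWeight =
      Function.update (s.realArr RealArr.cellWeight) (s.natVar NatReg.cells) (w s(u, v)))
    (hnext : s'.natArr NatArr.next =
      Function.update (s.natArr NatArr.next) (s.natVar NatReg.cells) (s.natArr NatArr.first u))
    (hfirst : s'.natArr NatArr.first =
      Function.update (s.natArr NatArr.first) u (s.natVar NatReg.cells + 1)) :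
    HasLists (fun x y => R x y ∨ x = u ∧ y = v) w s' := by
  intro x
  obtain ⟨vs, hnodup, hmem, hvs⟩ := h x
  have hvs' : IsLinkedList w x s' (s.natArr NatArr.first x) vs := by
    refine hvs.mono (by omega) fun e he => ?_
    simp [htarget, hweight, hnext, he.ne]
  rcases eq_or_ne x u with rfl | hxu
  · refine ⟨v :: vs, List.nodup_cons.2 ⟨(hmem v).not.2 huv, hnodup⟩, fun y => ?_, ?_⟩
    · rw [List.mem_cons, hmem, or_comm]
      simp
    · exact ⟨s.natVar NatReg.cells, by omega, by simp [hfirst], by simp [htarget],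
        by simp [hweight], by simpa [hnext] using hvs'⟩
  · refine ⟨vs, hnodup, fun y => ?_, ?_⟩
    · simp [hmem, hxu]
    · rwa [hfirst, Function.update_of_ne (Fin.val_injective.ne hxu)]

/-- Put the endpoint in array `b` of the current edge in front of the linked list of the endpoint in
array `a`. -/
def addArcProg (a b : ℕ) : Prog :=
  .putNat NatArr.target (.var NatReg.cells) (.get b (.var NatReg.index)) ⨾
  .putReal RealArr.cellWeight (.var NatReg.cells) (.get RealArr.weight (.var NatReg.index)) ⨾
  .putNat NatArr.next (.var NatReg.cells) (.get NatArr.first (.get a (.var NatReg.index))) ⨾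
  .putNat NatArr.first (.get a (.var NatReg.index)) (.plus (.var NatReg.cells) (.lit 1)) ⨾
  .setNat NatReg.cells (.plus (.var NatReg.cells) (.lit 1))

theorem addArcProg_runs {a b i : ℕ} (h : HasLists R w s) (ha : a ≠ NatArr.target)
    (ha' : a ≠ NatArr.next) (hi : s.natVar NatReg.index = i) (hu : s.natArr a i = u)
    (hv : s.natArr b i = v) (hw : s.realArr RealArr.weight i = w s(u, v)) (huv : ¬ R u v) :
    Runs (addArcProg a b) s fun T s' => T ≤ 30 ∧
      HasLists (fun x y => R x y ∨ x = u ∧ y = v) w s' := by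
  simp only [addArcProg, runs_seq, runs_putNat, runs_putReal, runs_setNat]
  refine ⟨by simp, h.insert huv ?_ ?_ ?_ ?_ ?_⟩ <;> simp [hi, hu, hv, hw, ha, ha']

/-- Build the linked lists of the neighbours of all vertices. -/
def listsProg : Prog :=
  clearProg ⨾
  .forTo NatReg.index NatReg.edges
    (addArcProg NatArr.src NatArr.dst ⨾ addArcProg NatArr.dst NatArr.src)

theorem addEdgeProg_runs (h : HasInput L w r s) {i : Fin m}
    (hi : s.natVar NatReg.index = i)
    (hlists : HasLists (fun u v => ∃ j < i, s(L.src j, L.dst j) = s(u, v)) w s) :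
    Runs (addArcProg NatArr.src NatArr.dst ⨾ addArcProg NatArr.dst NatArr.src) s fun T s' =>
      T ≤ 60 ∧ HasLists (fun u v => ∃ j ≤ i, s(L.src j, L.dst j) = s(u, v)) w s' := by
  have not_listed {u v : Fin n} (huv : s(u, v) = s(L.src i, L.dst i)) :
      ¬ ∃ j < i, s(L.src j, L.dst j) = s(u, v) :=
    fun ⟨j, hj, hj'⟩ => hj.ne (L.injective (hj'.trans huv))
  rw [runs_seq]
  refine (addArcProg_runs hlists (by decide) (by decide) hi (h.src i) (h.dst i) (h.weight i)
    (not_listed rfl)).mono ?_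
  rintro T₁ s₁ hs₁ ⟨hT₁, hlists₁⟩
  have h₁ := h.of_frame hs₁ (by decide)
  refine (addArcProg_runs hlists₁ (by decide) (by decide)
    ((hs₁.natVar _ (by decide)).trans hi) (h₁.dst i) (h₁.src i)
    ((h₁.weight i).trans (by rw [Sym2.eq_swap])) ?_).mono ?_
  · rintro (hlisted | ⟨hds, -⟩)
    · exact not_listed Sym2.eq_swap hlisted
    · exact (L.adj i).ne' hds
  · rintro T₂ s₂ - ⟨hT₂, hlists₂⟩
    refine ⟨by omega, ?_⟩
    convert hlists₂ using 3 with u v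
    simp only [le_iff_lt_or_eq, or_and_right, exists_or, exists_eq_left, or_assoc]
    grind

theorem listsProg_runs (h : HasInput L w r s) :
    Runs listsProg s fun T s' => T ≤ 30 * n + 70 * m + 40 ∧ HasLists G.Adj w s' ∧
      ∀ v < n, s'.natArr NatArr.rank v = 0 ∧ s'.natArr NatArr.seen v = 0 ∧
        s'.realArr RealArr.reach v = 0 := by
  rw [listsProg, runs_seq]
  refine (clearProg_runs h.size).mono ?_
  rintro T s₁ hs₁ ⟨hT, -, hzero⟩
  have h₁ : HasInput L w r s₁ := h.of_frame hs₁ (by decide)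
  refine (Runs.forTo (N := m)
    (fun i s' =>
      HasLists (fun u v => ∃ j : Fin m, j < i ∧ s(L.src j, L.dst j) = s(u, v)) w s') 60
    h₁.edges (by decide) (by decide) (by decide) ?_ ?_).mono ?_
  · refine fun u => ⟨[], by simp, by simp, (hzero u u.2).1⟩
  · intro i s' hi hs' hx hI
    refine (addEdgeProg_runs (i := ⟨i, hi⟩) (h₁.of_frame hs' (by decide)) hx hI).mono ?_
    rintro T s'' - ⟨hT, hlists⟩
    refine ⟨hT, ?_⟩
    simp only [Nat.lt_succ_iff]
    exact hlists.of_frame (.update_natVar ..) (by decide)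
  · rintro T₂ s₂ hs₂ ⟨hT₂, hlists⟩
    refine ⟨by omega, ?_, fun v hv => ?_⟩
    · convert hlists using 3 with u v
      simp [L.adj_iff]
    · rw [hs₂.natArr NatArr.rank (by decide), hs₂.natArr NatArr.seen (by decide),
        hs₂.realArr RealArr.reach (by decide)]
      exact (hzero v hv).2

end LinkedLists

section Queue

variable {q : ℕ → ℕ} {k : ℕ} {S : Set ℕ}

theorem bijOn_update_push (h : Set.BijOn q (Set.Iio k) S) {x : ℕ} (hx : x ∉ S) :
    Set.BijOn (Function.update q k x) (Set.Iio (k + 1)) (insert x S) := by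
  have h' : Set.BijOn (Function.update q k x) (Set.Iio k) S :=
    h.congr fun j (hj : j < k) => (Function.update_of_ne hj.ne x q).symm
  have := h'.insert (a := k) (by simpa using hx)
  rwa [Function.update_self, show insert k (Set.Iio k) = Set.Iio (k + 1) by ext; simp]
    at this

theorem bijOn_update_remove (h : Set.BijOn q (Set.Iio (k + 1)) S) {i : ℕ} (hi : i < k + 1) :
    Set.BijOn (Function.update q i (q k)) (Set.Iio k) (S \ {q i}) := by
  have hinj {j j' : ℕ} (hj : j < k + 1) (hj' : j' < k + 1) (heq : q j = q j') : j = j' :=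
    h.injOn hj hj' heq
  refine ⟨fun j (hj : j < k) => ?_, fun j (hj : j < k) j' (hj' : j' < k) heq => ?_, ?_⟩
  · rcases eq_or_ne j i with rfl | hji
    · rw [Function.update_self]
      exact ⟨h.mapsTo k.lt_succ_self, fun heq => hj.ne' (hinj k.lt_succ_self hi heq)⟩
    · rw [Function.update_of_ne hji]
      exact ⟨h.mapsTo (hj.trans k.lt_succ_self), fun heq => hji (hinj (by omega) hi heq)⟩
  · simp only [Function.update_apply] at heq
    split_ifs at heq with hji hji' hji'
    · exact hji.trans hji'.symm
    · exact absurd (hinj (by omega) (by omega) heq) (by omega)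
    · exact absurd (hinj (by omega) (by omega) heq) (by omega)
    · exact hinj (by omega) (by omega) heq
  · rintro _ ⟨hy, hne⟩
    obtain ⟨j, hj : j < k + 1, rfl⟩ := h.surjOn hy
    have hji : j ≠ i := fun hji => hne (congrArg q hji)
    rcases Nat.lt_succ_iff_lt_or_eq.1 hj with hjk | rfl
    · exact ⟨j, hjk, Function.update_of_ne hji _ _⟩
    · exact ⟨i, by simp only [Set.mem_Iio]; omega, Function.update_self ..⟩

theorem ncard_of_bijOn (h : Set.BijOn q (Set.Iio k) S) : S.ncard = k := by
  rw [← h.image_eq, h.injOn.ncard_image]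
  simp

end Queue

section Growing

variable {n m : ℕ} {G : SimpleGraph (Fin n)} {w : Sym2 (Fin n) → ℝ} {r x : Fin n}
  {L : EdgeList G m} {s s' : Store} {l : List (Fin n)} {S : Set (Fin n)} {b : Fin n → ℝ}

/-- The memory describes a stage of the greedy search at which the vertices of `l` have been
placed: their ranks are stored, the queue holds the vertices of `S`, and `b v` is the weight by
which `v` has been reached. -/
structure Tables (l : List (Fin n)) (S : Set (Fin n)) (b : Fin n → ℝ) (s : Store) : Prop where
  placed : s.natVar NatReg.placed = l.length
  rank : ∀ v : Fin n, s.natArr NatArr.rank v = rank l v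
  seen : ∀ v ∉ l, s.natArr NatArr.seen v = 0 ↔ v ∉ S
  reach : ∀ v : Fin n, s.realArr RealArr.reach v = b v
  queue : Set.BijOn (s.natArr NatArr.queue) (Set.Iio (s.natVar NatReg.queueSize)) (Fin.val '' S)

theorem Tables.of_frame {W : List Loc} (h : Tables l S b s) (hs : Frame W s s')
    (hW : ∀ x ∈ [.natVar NatReg.placed, .natVar NatReg.queueSize, .natArr NatArr.rank,
      .natArr NatArr.seen, .natArr NatArr.queue, .realArr RealArr.reach], x ∉ W) :
    Tables l S b s' where
  placed := (hs.natVar _ (hW _ (by decide))).trans h.placed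
  rank v := (congrFun (hs.natArr _ (hW _ (by decide))) v).trans (h.rank v)
  seen v hv := by rw [hs.natArr _ (hW _ (by decide))]; exact h.seen v hv
  reach v := (congrFun (hs.realArr _ (hW _ (by decide))) v).trans (h.reach v)
  queue := by
    rw [hs.natArr _ (hW _ (by decide)), hs.natVar _ (hW _ (by decide))]
    exact h.queue

theorem Tables.queueSize_eq (h : Tables l S b s) : s.natVar NatReg.queueSize = S.ncard := by
  rw [← ncard_of_bijOn h.queue, Set.ncard_image_of_injective _ Fin.val_injective]

/-- Find the position in the queue of a vertex that is reached by the largest weight. -/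
def scanProg : Prog :=
  .setNat NatReg.position (.lit 0) ⨾
  .forTo NatReg.index NatReg.queueSize
    (.branch (.realLe (.get RealArr.reach (.get NatArr.queue (.var NatReg.position)))
        (.get RealArr.reach (.get NatArr.queue (.var NatReg.index))))
      (.setNat NatReg.position (.var NatReg.index)) .skip)

theorem scanProg_runs {k : ℕ} (hk : s.natVar NatReg.queueSize = k) (hk' : 0 < k) :
    Runs scanProg s fun T s' => T ≤ 19 * k + 9 ∧ s'.natVar NatReg.position < k ∧
      ∀ i < k, s.realArr RealArr.reach (s.natArr NatArr.queue i) ≤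
        s.realArr RealArr.reach (s.natArr NatArr.queue (s'.natVar NatReg.position)) := by
  simp only [scanProg, runs_seq, runs_setNat]
  refine (Runs.forTo (N := k) (fun i s' => s'.natVar NatReg.position < k ∧
    ∀ j < i, s.realArr RealArr.reach (s.natArr NatArr.queue j) ≤
      s.realArr RealArr.reach (s.natArr NatArr.queue (s'.natVar NatReg.position))) 10
    (by simpa using hk) (by decide) (by decide) (by decide) (by simpa using hk') ?_).mono ?_
  · rintro i s' hi hs' hx ⟨hpos, hI⟩
    have hreach := hs'.realArr RealArr.reach (by decide)
    have hqueue := hs'.natArr NatArr.queue (by decide)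
    dsimp only at hreach hqueue
    simp only [runs_branch, runs_setNat, runs_skip, BExp.Holds, RExp.eval, NExp.eval, hx,
      hreach, hqueue]
    refine ⟨fun hle => ⟨by simp, by simpa using hi, fun j hj => ?_⟩,
      fun hle => ⟨by simp, by simpa using hpos, fun j hj => ?_⟩⟩
    all_goals
      rcases Nat.lt_succ_iff_lt_or_eq.1 hj with hj | rfl
    · simpa using (hI j hj).trans hle
    · simp
    · simpa using hI j hj
    · simpa using le_of_not_ge hle
  · rintro T s' - ⟨hT, hI⟩
    exact ⟨by simp only [NExp.cost]; omega, hI⟩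

/-- Move the vertex at the chosen position of the queue to the order that is being built. -/
def extractProg : Prog :=
  .setNat NatReg.vertex (.get NatArr.queue (.var NatReg.position)) ⨾
  .setNat NatReg.queueSize (.minus (.var NatReg.queueSize) (.lit 1)) ⨾
  .putNat NatArr.queue (.var NatReg.position) (.get NatArr.queue (.var NatReg.queueSize)) ⨾
  .setNat NatReg.placed (.plus (.var NatReg.placed) (.lit 1)) ⨾
  .putNat NatArr.rank (.var NatReg.vertex) (.var NatReg.placed) ⨾
  .setNat NatReg.pointer (.get NatArr.first (.var NatReg.vertex))

theorem extractProg_runs (h : Tables l S b s)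
    (hpos : s.natVar NatReg.position < s.natVar NatReg.queueSize)
    (hx : s.natArr NatArr.queue (s.natVar NatReg.position) = x) :
    Runs extractProg s fun T s' => T ≤ 23 ∧ Tables (x :: l) (S \ {x}) b s' ∧
      s'.natVar NatReg.pointer = s'.natArr NatArr.first x := by
  obtain ⟨k, hk⟩ := Nat.exists_eq_add_one.2 (Nat.zero_lt_of_lt hpos)
  simp only [extractProg, runs_seq, runs_putNat, runs_setNat]
  refine ⟨by simp, ⟨by simp [h.placed], fun v => ?_, fun v hv => ?_, fun v => ?_, ?_⟩,
    by simp [hx]⟩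
  · by_cases hvx : v = x
    · simp [hx, hvx, rank, h.placed]
    · simp [hx, hvx, rank, h.rank, Fin.val_inj]
  · rw [List.mem_cons, not_or] at hv
    simpa [hv.1] using h.seen v hv.2
  · simpa using h.reach v
  · have := bijOn_update_remove (hk ▸ h.queue) (hk ▸ hpos)
    rw [hx, ← Set.image_singleton, ← Set.image_sdiff Fin.val_injective] at this
    simpa [hk] using this

theorem Tables.mem_iff (h : Tables l S b s) (v : Fin n) : s.natArr NatArr.rank v ≤ 0 ↔ v ∉ l := by
  rw [h.rank, ← rank_pos_iff, not_lt]

/-- Choose the vertex of the queue that is reached by the largest weight. -/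
def selectProg : Prog := scanProg ⨾ extractProg

theorem selectProg_runs (h : Tables l S b s) (hS : S.Nonempty) :
    Runs selectProg s fun T s' => T ≤ 19 * S.ncard + 32 ∧ ∃ x ∈ S, (∀ v ∈ S, b v ≤ b x) ∧
      Tables (x :: l) (S \ {x}) b s' ∧ s'.natVar NatReg.pointer = s'.natArr NatArr.first x := by
  rw [selectProg, runs_seq]
  refine (scanProg_runs h.queueSize_eq ((Set.ncard_pos S.toFinite).2 hS)).mono ?_
  rintro T s₁ hs₁ ⟨hT, hpos, hmax⟩
  have h₁ : Tables l S b s₁ := h.of_frame hs₁ (by decide)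
  rw [← h₁.queueSize_eq] at hpos
  obtain ⟨x, hxS, hx⟩ := h₁.queue.mapsTo hpos
  refine (extractProg_runs h₁ hpos hx.symm).mono ?_
  rintro T' s₂ - ⟨hT', h₂, hpointer⟩
  refine ⟨by omega, x, hxS, fun v hv => ?_, h₂, hpointer⟩
  obtain ⟨i, hi, hiv⟩ := h.queue.surjOn (Set.mem_image_of_mem _ hv)
  rw [Set.mem_Iio, h.queueSize_eq] at hi
  simpa only [hiv, ← hs₁.natArr NatArr.queue (by decide), ← hx, h.reach] using hmax i hi

/-- Account for an edge to the current vertex from a vertex that has been placed, and add the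
current vertex to the queue if it is new. -/
def reachProg : Prog :=
  .putReal RealArr.reach (.var NatReg.vertex)
    (.plus (.get RealArr.reach (.var NatReg.vertex))
      (.get RealArr.cellWeight (.var NatReg.cell))) ⨾
  .branch (.natLe (.get NatArr.seen (.var NatReg.vertex)) (.lit 0))
    (.putNat NatArr.seen (.var NatReg.vertex) (.lit 1) ⨾
    .putNat NatArr.queue (.var NatReg.queueSize) (.var NatReg.vertex) ⨾
    .setNat NatReg.queueSize (.plus (.var NatReg.queueSize) (.lit 1)))
    .skip

theorem reachProg_runs {v : Fin n} {c : ℝ} (h : Tables l S b s) (hv : v ∉ l)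
    (hvertex : s.natVar NatReg.vertex = v)
    (hweight : s.realArr RealArr.cellWeight (s.natVar NatReg.cell) = c) :
    Runs reachProg s fun T s' => T ≤ 30 ∧
      Tables l (insert v S) (Function.update b v (b v + c)) s' := by
  have hreach (u : Fin n) : Function.update (s.realArr RealArr.reach) v (b v + c) u =
      Function.update b v (b v + c) u := by
    simp [Function.update_apply, h.reach, Fin.val_inj]
  simp only [reachProg, runs_seq, runs_setNat, runs_putNat, runs_putReal, runs_branch, runs_skip,
    BExp.Holds, RExp.eval, NExp.eval, hvertex, hweight, h.reach]
  refine ⟨fun hnew => ⟨by simp, ?_⟩, fun hold => ⟨by simp, ?_⟩⟩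
  · have hvS : v ∉ S := (h.seen v hv).1 (Nat.le_zero.1 hnew)
    refine ⟨by simp [h.placed], by simpa using h.rank, fun u hu => ?_, by simpa using hreach, ?_⟩
    · by_cases huv : u = v
      · simp [huv]
      · simpa [huv, Fin.val_inj] using h.seen u hu
    · rw [Set.image_insert_eq]
      simpa using bijOn_update_push h.queue (Fin.val_injective.mem_set_image.not.2 hvS)
  · have hvS : v ∈ S := not_not.1 ((h.seen v hv).not.1 (by simpa using hold))
    rw [Set.insert_eq_of_mem hvS]
    exact ⟨h.placed, h.rank, h.seen, by simpa using hreach, h.queue⟩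

/-- Load the vertex in the current cell of a linked list. -/
def loadProg : Prog :=
  .setNat NatReg.cell (.minus (.var NatReg.pointer) (.lit 1)) ⨾
  .setNat NatReg.vertex (.get NatArr.target (.var NatReg.cell))

/-- Handle an edge from a vertex that has been placed to the current vertex. -/
def scanArcProg : Prog :=
  .branch (.natLe (.get NatArr.rank (.var NatReg.vertex)) (.lit 0)) reachProg .skip

theorem scanArcProg_runs {v : Fin n} (h : Tables l S b s) (hvertex : s.natVar NatReg.vertex = v)
    (hweight : s.realArr RealArr.cellWeight (s.natVar NatReg.cell) = w s(x, v)) :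
    Runs scanArcProg s fun T s' => T ≤ 40 ∧ Tables l (S ∪ {u | u ∉ l ∧ u = v})
      (fun u => b u + if u ∉ l ∧ u = v then w s(x, u) else 0) s' := by
  simp only [scanArcProg, runs_branch, runs_skip, BExp.Holds, NExp.eval, hvertex, h.mem_iff,
    not_not]
  refine ⟨fun hv => (reachProg_runs h hv hvertex hweight).mono ?_, fun hv => ⟨by simp, ?_⟩⟩
  · rintro T s' - ⟨hT, h'⟩
    refine ⟨by simp only [BExp.cost, NExp.cost]; omega, ?_⟩
    convert h' using 1
    · grind
    · grind
  · convert h using 1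
    · grind
    · grind

/-- Handle the current cell of a linked list and move on to the next one. -/
def visitProg : Prog :=
  loadProg ⨾ scanArcProg ⨾ .setNat NatReg.pointer (.get NatArr.next (.var NatReg.cell))

theorem visitProg_runs {v : Fin n} {vs : List (Fin n)} (h : Tables l S b s)
    (hvs : IsLinkedList w x s (s.natVar NatReg.pointer) (v :: vs)) :
    Runs visitProg s fun T s' => T ≤ 60 ∧ IsLinkedList w x s' (s'.natVar NatReg.pointer) vs ∧
      Tables l (S ∪ {u | u ∉ l ∧ u = v}) (fun u => b u + if u ∉ l ∧ u = v then w s(x, u) else 0)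
        s' := by
  obtain ⟨e, -, hp, htarget, hweight, hnext⟩ := hvs
  have hload : Runs loadProg s fun T s' => T ≤ 10 ∧ s'.natVar NatReg.cell = e ∧
      s'.natVar NatReg.vertex = v := by
    simp [loadProg, hp, htarget]
  rw [visitProg, runs_seq]
  refine hload.mono ?_
  rintro T₁ s₁ hs₁ ⟨hT₁, hcell, hvertex⟩
  have h₁ : Tables l S b s₁ := h.of_frame hs₁ (by decide)
  have hweight₁ : s₁.realArr RealArr.cellWeight (s₁.natVar NatReg.cell) = w s(x, v) := by
    rwa [hcell, hs₁.realArr _ (by decide)]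
  rw [runs_seq]
  refine (scanArcProg_runs h₁ hvertex hweight₁).mono ?_
  rintro T₂ s₂ hs₂ ⟨hT₂, h₂⟩
  have hcell₂ : s₂.natVar NatReg.cell = e := (hs₂.natVar _ (by decide)).trans hcell
  rw [runs_setNat]
  refine ⟨by simp only [NExp.cost]; omega, ?_, ?_⟩
  · have hnext₂ := (hnext.of_frame hs₁ (by decide)).of_frame hs₂ (by decide)
    rw [← hs₁.natArr _ (by decide), ← hs₂.natArr _ (by decide)] at hnext₂
    simpa [hcell₂] using hnext₂.of_frame (.update_natVar _ NatReg.pointer _) (by decide)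
  · exact h₂.of_frame (.update_natVar _ _ _) (by decide)

/-- Handle all cells of a linked list. -/
def followProg : Prog := .loop (.natLe (.lit 1) (.var NatReg.pointer)) visitProg

theorem followProg_runs {vs : List (Fin n)} (h : Tables l S b s) (hnodup : vs.Nodup)
    (hvs : IsLinkedList w x s (s.natVar NatReg.pointer) vs) :
    Runs followProg s fun T s' => T ≤ 64 * vs.length + 4 ∧
      Tables l (S ∪ {u | u ∉ l ∧ u ∈ vs})
        (fun u => b u + if u ∉ l ∧ u ∈ vs then w s(x, u) else 0) s' := by
  induction vs generalizing s S b with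
  | nil =>
    refine runs_loop.2 ⟨fun hp => ?_, fun _ => ⟨by simp, by simpa using h⟩⟩
    simp [show s.natVar NatReg.pointer = 0 from hvs] at hp
  | cons v vs ih =>
    obtain ⟨hv, hnodup⟩ := List.nodup_cons.1 hnodup
    refine runs_loop.2 ⟨fun _ => (visitProg_runs h hvs).mono ?_, fun hp => ?_⟩
    · rintro T s' - ⟨hT, hvs', h'⟩
      refine (ih h' hnodup hvs').mono ?_
      rintro T' s'' - ⟨hT', h''⟩
      refine ⟨by simp only [BExp.cost, NExp.cost, List.length_cons]; omega, ?_⟩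
      convert h'' using 1
      · ext u
        simp only [Set.mem_union, Set.mem_ofPred_eq, List.mem_cons]
        tauto
      · grind
    · obtain ⟨e, -, hp', -⟩ := hvs
      simp [hp'] at hp

/-- Place the next vertex of the order. -/
def placeProg : Prog := selectProg ⨾ followProg

theorem placeProg_runs (hl : GreedyOrder G w r l) (hlists : HasLists G.Adj w s)
    (h : Tables l (frontier G r l) (backWeight G w l) s) (hne : (frontier G r l).Nonempty) :
    Runs placeProg s fun T s' => ∃ x ∉ l, GreedyOrder G w r (x :: l) ∧
      T ≤ 19 * (frontier G r l).ncard + 64 * (G.neighborSet x).ncard + 36 ∧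
      Tables (x :: l) (frontier G r (x :: l)) (backWeight G w (x :: l)) s' := by
  rw [placeProg, runs_seq]
  refine (selectProg_runs h hne).mono ?_
  rintro T₁ s₁ hs₁ ⟨hT₁, x, hx, hmax, h₁, hpointer⟩
  obtain ⟨vs, hnodup, hmem, hvs⟩ := hlists.of_frame hs₁ (by decide) x
  rw [← hpointer] at hvs
  have hlength : vs.length = (G.neighborSet x).ncard := by
    rw [← List.toFinset_card_of_nodup hnodup, ← Set.ncard_coe_finset]
    congr 1
    ext v
    simp [hmem]
  refine (followProg_runs h₁ hnodup hvs).mono ?_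
  rintro T₂ s₂ - ⟨hT₂, h₂⟩
  refine ⟨x, hx.1, hl.cons hx hmax, by omega, ?_⟩
  convert h₂ using 1
  · ext v
    simp only [mem_frontier_cons, Set.mem_union, Set.mem_sdiff, Set.mem_singleton_iff,
      Set.mem_ofPred_eq, hmem, List.mem_cons]
    tauto
  · funext v
    simp only [backWeight, ← hmem]

/-- Put the root into the queue. -/
def startProg : Prog :=
  .setNat NatReg.placed (.lit 0) ⨾
  .setNat NatReg.queueSize (.lit 1) ⨾
  .putNat NatArr.queue (.lit 0) (.var NatReg.root) ⨾
  .putNat NatArr.seen (.var NatReg.root) (.lit 1)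

theorem startProg_runs (hroot : s.natVar NatReg.root = r)
    (hzero : ∀ v < n, s.natArr NatArr.rank v = 0 ∧ s.natArr NatArr.seen v = 0 ∧
      s.realArr RealArr.reach v = 0) :
    Runs startProg s fun T s' => T ≤ 10 ∧ Tables [] {r} (fun _ => 0) s' := by
  simp only [startProg, runs_seq, runs_setNat, runs_putNat]
  refine ⟨by simp, by simp, fun v => ?_, fun v _ => ?_, fun v => ?_, ?_⟩
  · simpa [rank] using (hzero v v.2).1
  · by_cases hvr : v = r
    · simp [hroot, hvr]
    · simpa [hroot, hvr, Fin.val_inj] using (hzero v v.2).2.1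
  · simpa using (hzero v v.2).2.2
  · simp [hroot]

/-- Place all vertices, the root first. -/
def growProg : Prog :=
  startProg ⨾ .loop (.natLe (.lit 1) (.var NatReg.queueSize)) placeProg

theorem sum_ncard_neighborSet (L : EdgeList G m) : ∑ v, (G.neighborSet v).ncard = 2 * m := by
  classical
  rw [← L.ncard_edgeSet, ← SimpleGraph.coe_edgeFinset, Set.ncard_coe_finset,
    ← G.sum_degrees_eq_twice_card_edges]
  simp only [← G.card_neighborFinset_eq_degree, ← G.coe_neighborFinset, Set.ncard_coe_finset]

theorem growProg_runs {f : ℕ} (L : EdgeList G m) (hG : G.Connected)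
    (hf : ∀ l, GreedyOrder G w r l → (frontier G r l).ncard ≤ f)
    (hroot : s.natVar NatReg.root = r) (hlists : HasLists G.Adj w s)
    (hzero : ∀ v < n, s.natArr NatArr.rank v = 0 ∧ s.natArr NatArr.seen v = 0 ∧
      s.realArr RealArr.reach v = 0) :
    Runs growProg s fun T s' => T ≤ n * (19 * f + 40) + 128 * m + 20 ∧
      ∃ l, GreedyOrder G w r l ∧ (∀ v, v ∈ l) ∧
        (∀ v : Fin n, s'.natArr NatArr.rank v = rank l v) ∧
        ∀ v : Fin n, s'.realArr RealArr.reach v = backWeight G w l v := by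
  rw [growProg, runs_seq]
  let cost (v : Fin n) := 19 * f + 64 * (G.neighborSet v).ncard + 40
  refine (startProg_runs hroot hzero).mono ?_
  rintro T₁ s₁ hs₁ ⟨hT₁, h₁⟩
  have hlists₁ := hlists.of_frame hs₁ (by decide)
  have h₁ : Tables [] (frontier G r []) (backWeight G w []) s₁ := by
    rwa [frontier_nil]
  refine (Runs.loop (k := ∑ v, cost v) (fun k s' => ∃ l, GreedyOrder G w r l ∧
    k = ∑ v ∈ Finset.univ \ l.toFinset, cost v ∧
    Tables l (frontier G r l) (backWeight G w l) s') ⟨[], .nil, by simp, h₁⟩ ?_).mono ?_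
  · rintro _ s' hs' ⟨l, hl, rfl, h⟩ hb
    have hne : (frontier G r l).Nonempty := by
      rw [← Set.ncard_pos (Set.toFinite _), ← h.queueSize_eq]
      exact hb
    refine (placeProg_runs hl (hlists₁.of_frame hs' (by decide)) h hne).mono ?_
    rintro T s'' - ⟨x, hx, hl', hT, h'⟩
    refine ⟨_, ⟨x :: l, hl', rfl, h'⟩, ?_⟩
    have hsum := Finset.add_sum_erase (Finset.univ \ l.toFinset) cost (a := x) (by simpa using hx)
    rw [← Finset.sdiff_insert, ← List.toFinset_cons] at hsum
    have hcost : cost x = 19 * f + 64 * (G.neighborSet x).ncard + 40 := rfl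
    have := hf l hl
    simp only [BExp.cost, NExp.cost]
    omega
  · rintro T s' - ⟨hT, ⟨_, -, l, hl, -, h⟩, hb⟩
    have hempty : frontier G r l = ∅ := by
      rw [← Set.ncard_eq_zero (Set.toFinite _), ← h.queueSize_eq]
      simpa using hb
    refine ⟨?_, l, hl, mem_of_frontier_eq_empty hempty hG, h.rank, h.reach⟩
    have hcost : ∑ v, cost v = n * (19 * f + 40) + 64 * (2 * m) := by
      rw [← sum_ncard_neighborSet L, Finset.mul_sum]
      simp only [cost, Finset.sum_add_distrib, Finset.sum_const, Finset.card_univ,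
        Fintype.card_fin, smul_eq_mul]
      ring
    simp only [BExp.cost, NExp.cost] at hT
    omega

end Growing

section Solving

variable {n m : ℕ} {G : SimpleGraph (Fin n)} {w : Sym2 (Fin n) → ℝ} {r : Fin n}
  {L : EdgeList G m} {s s' : Store}

theorem outDigraph_eq_orientBy {f : Fin n → ℕ} (hf : Function.Injective f)
    (hflag : ∀ i : Fin m, s.natArr NatArr.flag i = 0 ↔ f (L.src i) ≤ f (L.dst i)) :
    outDigraph L s = orientBy G f := by
  ext u v
  change (∃ i, _) ↔ G.Adj u v ∧ f u < f v
  rw [L.adj_iff]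
  constructor
  · rintro ⟨i, ⟨h, rfl, rfl⟩ | ⟨h, rfl, rfl⟩⟩
    · exact ⟨⟨i, rfl⟩, ((hflag i).1 h).lt_of_ne (hf.ne (L.adj i).ne)⟩
    · exact ⟨⟨i, Sym2.eq_swap⟩, not_le.1 ((hflag i).not.1 h)⟩
  · rintro ⟨⟨i, hi⟩, hlt⟩
    rcases Sym2.eq_iff.1 hi with ⟨rfl, rfl⟩ | ⟨rfl, rfl⟩
    · exact ⟨i, .inl ⟨(hflag i).2 hlt.le, rfl, rfl⟩⟩
    · exact ⟨i, .inr ⟨(hflag i).not.2 hlt.not_ge, rfl, rfl⟩⟩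

/-- Direct each edge towards the endpoint that has been placed later. -/
def orientProg : Prog :=
  .forTo NatReg.index NatReg.edges
    (.branch (.natLe (.get NatArr.rank (.get NatArr.src (.var NatReg.index)))
        (.get NatArr.rank (.get NatArr.dst (.var NatReg.index))))
      (.putNat NatArr.flag (.var NatReg.index) (.lit 0))
      (.putNat NatArr.flag (.var NatReg.index) (.lit 1)))

theorem orientProg_runs (h : HasInput L w r s) {f : Fin n → ℕ} (hf : Function.Injective f)
    (hrank : ∀ v : Fin n, s.natArr NatArr.rank v = f v) :
    Runs orientProg s fun T s' => T ≤ 20 * m + 7 ∧ outDigraph L s' = orientBy G f := by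
  refine (Runs.forTo (N := m) (fun i s' => ∀ j : Fin m, j < i →
    (s'.natArr NatArr.flag j = 0 ↔ f (L.src j) ≤ f (L.dst j))) 11
    h.edges (by decide) (by decide) (by decide) (by simp) ?_).mono ?_
  · intro i s' hi hs' hx hI
    have hle : s'.natArr NatArr.rank (s'.natArr NatArr.src i) ≤
        s'.natArr NatArr.rank (s'.natArr NatArr.dst i) ↔ f (L.src ⟨i, hi⟩) ≤ f (L.dst ⟨i, hi⟩) := by
      rw [hs'.natArr NatArr.rank (by decide), (h.of_frame hs' (by decide)).src ⟨i, hi⟩,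
        (h.of_frame hs' (by decide)).dst ⟨i, hi⟩, hrank, hrank]
    simp only [runs_branch, runs_putNat, BExp.Holds, NExp.eval, hx, hle]
    refine ⟨fun hle' => ⟨by simp, fun j hj => ?_⟩, fun hle' => ⟨by simp, fun j hj => ?_⟩⟩
    all_goals
      rcases Nat.lt_succ_iff_lt_or_eq.1 hj with hj | rfl
    · simpa [hj.ne] using hI j hj
    · simpa using hle'
    · simpa [hj.ne] using hI j hj
    · simpa using hle'
  · rintro T s' - ⟨hT, hI⟩
    exact ⟨by omega, outDigraph_eq_orientBy hf fun i => hI i i.2⟩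

/-- Lower the real register `x` to the minimum of its value and of the values of `e` at the vertices
other than the root, where `e` refers to the current vertex by the register `index`. -/
def minProg (x : ℕ) (e : RExp) : Prog :=
  .forTo NatReg.index NatReg.size
    (.branch (.both (.neg (.both (.natLe (.var NatReg.index) (.var NatReg.root))
        (.natLe (.var NatReg.root) (.var NatReg.index)))) (.realLe e (.var x)))
      (.setReal x e) .skip)

theorem minProg_runs {x : ℕ} {e : RExp} {f : Fin n → ℝ} (hsize : s.natVar NatReg.size = n)
    (hroot : s.natVar NatReg.root = r)
    (he : ∀ (v : Fin n) s', Frame (minProg x e).writes s s' → s'.natVar NatReg.index = v →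
      e.eval s' = f v) :
    Runs (minProg x e) s fun T s' => T ≤ n * (2 * e.cost + 30) + 7 ∧
      IsLeast (insert (s.realVar x) {y | ∃ v, v ≠ r ∧ y = f v}) (s'.realVar x) := by
  refine (Runs.forTo (N := n) (fun i s' =>
    IsLeast (insert (s.realVar x) {y | ∃ v : Fin n, v < i ∧ v ≠ r ∧ y = f v}) (s'.realVar x))
    (2 * e.cost + 21) hsize (by decide) (by simp [Prog.writes]) (by simp [Prog.writes])
    (by simp) ?_).mono ?_
  · intro i s' hi hs' hx hI
    have hroot' : s'.natVar NatReg.root = r := by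
      rw [hs'.natVar NatReg.root (by simp [Prog.forTo, Prog.writes]), hroot]
    have hne : ¬ (i ≤ (r : ℕ) ∧ (r : ℕ) ≤ i) ↔ (⟨i, hi⟩ : Fin n) ≠ r := by
      rw [← le_antisymm_iff, Ne, Fin.ext_iff]
    simp only [runs_branch, runs_skip, runs_setReal, BExp.Holds, NExp.eval, RExp.eval, hx, hroot',
      he ⟨i, hi⟩ s' hs' hx, hne]
    have hset : {y | ∃ v : Fin n, v < i + 1 ∧ v ≠ r ∧ y = f v} =
        {y | (⟨i, hi⟩ : Fin n) ≠ r ∧ y = f ⟨i, hi⟩} ∪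
          {y | ∃ v : Fin n, v < i ∧ v ≠ r ∧ y = f v} := by
      ext y
      constructor
      · rintro ⟨v, hv, h⟩
        rcases Nat.lt_succ_iff_lt_or_eq.1 hv with hv | rfl
        exacts [.inr ⟨v, hv, h⟩, .inl h]
      · rintro (h | ⟨v, hv, h⟩)
        exacts [⟨_, Nat.lt_succ_self i, h⟩, ⟨v, Nat.lt_succ_of_lt hv, h⟩]
    rw [hset, ← Set.union_insert]
    refine ⟨fun ⟨hv, hlt⟩ => ⟨by simp only [BExp.cost, NExp.cost, RExp.cost]; omega, ?_⟩,
      fun hn => ⟨by simp only [BExp.cost, NExp.cost, RExp.cost]; omega, ?_⟩⟩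
    · simpa [hv, Set.insert_comm, min_eq_left hlt] using hI.insert (f ⟨i, hi⟩)
    · by_cases hv : (⟨i, hi⟩ : Fin n) = r
      · simpa [hv] using hI
      · have hlt := (not_le.1 fun h => hn ⟨hv, h⟩).le
        simpa [hv, Set.insert_comm, min_eq_right hlt] using hI.insert (f ⟨i, hi⟩)
  · rintro T s' - ⟨hT, hI⟩
    refine ⟨by omega, ?_⟩
    simpa using hI

/-- Set `value` to the least number in the array `reach` of a vertex other than the root, starting
with vertex `1 - root`, which by truncation is vertex `0` unless the root is. -/
def valueProg : Prog :=
  .setReal RealReg.value (.get RealArr.reach (.minus (.lit 1) (.var NatReg.root))) ⨾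
  minProg RealReg.value (.get RealArr.reach (.var NatReg.index))

theorem valueProg_runs {f : Fin n → ℝ} (hn : 2 ≤ n) (h : HasInput L w r s)
    (hreach : ∀ v : Fin n, s.realArr RealArr.reach v = f v) :
    Runs valueProg s fun T s' => T ≤ n * 34 + 13 ∧
      IsLeast {x | ∃ v, v ≠ r ∧ x = f v} (s'.realVar RealReg.value) := by
  obtain ⟨v, hv⟩ : ∃ v : Fin n, (v : ℕ) = 1 - r := ⟨⟨1 - r, by omega⟩, rfl⟩
  have hvr : v ≠ r := fun h => by rw [h] at hv; omega
  rw [valueProg, runs_seq, runs_setReal]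
  refine (minProg_runs (r := r) (f := f) ?_ ?_ ?_).mono ?_
  · exact h.size
  · exact h.root
  · intro u s' hs' hu
    simp only [RExp.eval, NExp.eval, hu, hs'.realArr RealArr.reach (by decide), hreach]
  · rintro T s' - ⟨hT, hmin⟩
    refine ⟨by simp only [RExp.cost, NExp.cost] at hT ⊢; omega, ?_⟩
    have hinit : s.realArr RealArr.reach (1 - r) = f v := by rw [← hv, hreach]
    simpa [h.root, hinit, Set.insert_eq_of_mem (s := {x | ∃ v, v ≠ r ∧ x = f v}) ⟨v, hvr, rfl⟩]
      using hmin

/-- The memory holds an `r`-acyclic orientation of `G`, and its minimum weighted indegree, which is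
the largest possible, in the register `value`. -/
structure IsSolved (L : EdgeList G m) (w : Sym2 (Fin n) → ℝ) (r : Fin n) (s : Store) : Prop where
  input : HasInput L w r s
  rootedAcyclic : IsRootedAcyclic G r (outDigraph L s)
  isLeast : IsLeast {x | ∃ v, v ≠ r ∧ x = inWeight (outDigraph L s) w v}
    (s.realVar RealReg.value)
  le_value : ∀ x, IsFeasible G w r x → x ≤ s.realVar RealReg.value

/-- Compute an optimal `r`-acyclic orientation and its minimum weighted indegree. -/
def solveProg : Prog := listsProg ⨾ growProg ⨾ orientProg ⨾ valueProg

theorem EdgeList.le_two_mul (L : EdgeList G m) (hG : G.Connected) (hn : 2 ≤ n) : n ≤ 2 * m := by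
  have h := hG.card_vert_le_card_edgeSet_add_one
  rw [Nat.card_eq_fintype_card, Fintype.card_fin, Nat.card_coe_set_eq, L.ncard_edgeSet] at h
  omega

theorem solveProg_runs {f : ℕ} (hG : G.Connected) (hn : 2 ≤ n) (hw : ∀ e ∈ G.edgeSet, 0 ≤ w e)
    (hf : ∀ l, GreedyOrder G w r l → (frontier G r l).ncard ≤ f) (h : HasInput L w r s) :
    Runs solveProg s fun T s' => T ≤ 600 * ((f + 1) * m) ∧ IsSolved L w r s' := by
  simp only [solveProg, runs_seq]
  refine (listsProg_runs h).mono ?_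
  rintro T₁ s₁ hs₁ ⟨hT₁, hlists, hzero⟩
  have h₁ := h.of_frame hs₁ (by decide)
  refine (growProg_runs L hG hf h₁.root hlists hzero).mono ?_
  rintro T₂ s₂ hs₂ ⟨hT₂, l, hl, hall, hrank, hreach⟩
  have h₂ := h₁.of_frame hs₂ (by decide)
  refine (orientProg_runs h₂ (f := rank l) (fun u v => eq_of_rank_eq (hall u)) hrank).mono ?_
  rintro T₃ s₃ hs₃ ⟨hT₃, hD⟩
  have h₃ := h₂.of_frame hs₃ (by decide)
  refine (valueProg_runs (f := backWeight G w l) hn h₃ ?_).mono ?_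
  · simpa only [hs₃.realArr RealArr.reach (by decide)] using hreach
  rintro T₄ s₄ hs₄ ⟨hT₄, hmin⟩
  have hflag : s₄.natArr 2 = s₃.natArr 2 := hs₄.natArr NatArr.flag (by decide)
  have hD₄ : outDigraph L s₄ = orientBy G (rank l) := by
    rw [← hD, outDigraph, outDigraph, hflag]
  refine ⟨?_, h₃.of_frame hs₄ (by decide), ?_, ?_, fun x hx => ?_⟩
  · have hnm := L.le_two_mul hG hn
    have hmul : n * (19 * f) ≤ 2 * m * (19 * f) := Nat.mul_le_mul_right _ hnm
    rw [Nat.mul_add] at hT₂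
    rw [Nat.add_mul, one_mul, mul_comm f]
    have : 2 * m * (19 * f) = 38 * (m * f) := by ring
    omega
  · exact hD₄ ▸ hl.isRootedAcyclic_orientBy hall
  · simpa only [hD₄, hl.inWeight_orientBy hall] using hmin
  · obtain ⟨v, hv, hvalue⟩ := hmin.1
    exact hvalue ▸ hl.le_backWeight hw hx (hall v) hv

end Solving

section ParentFunctions

variable {V : Type*} {G : SimpleGraph V} {D : Digraph V} {w : Sym2 V → ℝ} {r u v : V} {t : ℕ}
  {lam : ℕ → ℝ} {par : ℕ → V → V}

/-- The digraph in which `p v` is the only in-neighbour of each vertex `v ≠ r`. -/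
def parentDigraph (r : V) (p : V → V) : Digraph V where
  Adj u v := v ≠ r ∧ p v = u

theorem isArborescence_parentDigraph [Finite V] (hD : ∀ v, ¬ Relation.TransGen D.Adj v v)
    {p : V → V} (hp : ∀ v, v ≠ r → D.Adj (p v) v) : IsArborescence D r (parentDigraph r p) where
  le := by
    rintro _ v ⟨hv, rfl⟩
    exact hp v hv
  root _ h := h.1 rfl
  parent v hv := ⟨p v, ⟨hv, rfl⟩, fun _ h => h.2.symm⟩
  reachable v := by
    have : Std.Irrefl (Relation.TransGen D.Adj) := ⟨hD⟩
    have hwf := Finite.wellFounded_of_trans_of_irrefl (Relation.TransGen D.Adj)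
    induction v using hwf.induction with
    | _ v ih =>
      by_cases hv : v = r
      · rw [hv]
      · exact (ih (p v) (.single (hp v hv))).tail ⟨hv, rfl⟩

open Classical in
/-- The weight of the arc from `u` to `v` that is left by the first `t` of the trees with parent
functions `par j` and coefficients `lam j`. -/
noncomputable def residual (w : Sym2 V → ℝ) (lam : ℕ → ℝ) (par : ℕ → V → V) (t : ℕ) (u v : V) : ℝ :=
  w s(u, v) - ∑ j ∈ Finset.range t, if par j v = u then lam j else 0

open Classical in
theorem residual_succ_update (c : ℝ) (p : V → V) :
    residual w (Function.update lam t c) (Function.update par t p) (t + 1) u v =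
      residual w lam par t u v - if p v = u then c else 0 := by
  rw [residual, residual, Finset.sum_range_succ, Function.update_self, Function.update_self,
    sub_add_eq_sub_sub]
  congr 2
  refine Finset.sum_congr rfl fun j hj => ?_
  have hjt := (Finset.mem_range.1 hj).ne
  rw [Function.update_of_ne hjt, Function.update_of_ne hjt]

/-- A packing of `r`-arborescences of an acyclic digraph, given by parent functions. -/
structure IsParentPacking (D : Digraph V) (w : Sym2 V → ℝ) (r : V) (lam : ℕ → ℝ) (par : ℕ → V → V)
    (t : ℕ) : Prop where
  pos : ∀ j < t, 0 < lam j
  adj : ∀ j < t, ∀ v, v ≠ r → D.Adj (par j v) v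
  residual_nonneg : ∀ u v, D.Adj u v → 0 ≤ residual w lam par t u v

theorem IsParentPacking.isPacking [Finite V] (h : IsParentPacking D w r lam par t)
    (hD : ∀ v, ¬ Relation.TransGen D.Adj v v) :
    IsPacking D w r (fun j : Fin t => lam j) fun j => parentDigraph r (par j) where
  pos j := h.pos j j.2
  arborescence j := isArborescence_parentDigraph hD (h.adj j j.2)
  capacity u v huv := by
    classical
    have hres := h.residual_nonneg u v huv
    rw [residual, sub_nonneg, Finset.sum_range] at hres
    refine (Finset.sum_le_sum fun j _ => ?_).trans hres
    have hj := h.pos j j.2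
    split_ifs with hv hpar
    exacts [le_rfl, absurd hv.2 hpar, hj.le, le_rfl]

theorem IsParentPacking.exists_residual_pos [Fintype V] (h : IsParentPacking D w r lam par t)
    (hv : v ≠ r) (hlt : ∑ j ∈ Finset.range t, lam j < inWeight D w v) :
    ∃ u, D.Adj u v ∧ 0 < residual w lam par t u v := by
  classical
  by_contra! hres
  refine hlt.not_ge ?_
  have lam_eq (j) (hj : j ∈ Finset.range t) :
      lam j = ∑ u, if D.Adj u v then if par j v = u then lam j else 0 else 0 := by
    rw [Finset.sum_eq_single (par j v), if_pos (h.adj j (Finset.mem_range.1 hj) v hv), if_pos rfl]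
    · rintro u - hu
      rw [if_neg hu.symm, ite_self]
    · simp
  rw [Finset.sum_congr rfl lam_eq, Finset.sum_comm, inWeight]
  refine Finset.sum_le_sum fun u _ => ?_
  split_ifs with huv
  · exact sub_nonpos.1 (hres u huv)
  · simp

theorem IsParentPacking.update (h : IsParentPacking D w r lam par t) (hr : ∀ u, ¬ D.Adj u r)
    {c : ℝ} (hc : 0 < c) {p : V → V} (hp : ∀ v, v ≠ r → D.Adj (p v) v)
    (hcp : ∀ v, v ≠ r → c ≤ residual w lam par t (p v) v) :
    IsParentPacking D w r (Function.update lam t c) (Function.update par t p) (t + 1) where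
  pos j hj := by
    rcases Nat.lt_succ_iff_lt_or_eq.1 hj with hj | rfl
    · simpa [hj.ne] using h.pos j hj
    · simpa using hc
  adj j hj := by
    rcases Nat.lt_succ_iff_lt_or_eq.1 hj with hj | rfl
    · simpa [hj.ne] using h.adj j hj
    · simpa using hp
  residual_nonneg u v huv := by
    classical
    rw [residual_succ_update, sub_nonneg]
    split_ifs with hpv
    · exact hpv ▸ hcp v fun hv => hr u (hv ▸ huv)
    · exact h.residual_nonneg u v huv

end ParentFunctions

section PackingProgram

variable {n m t : ℕ} {G : SimpleGraph (Fin n)} {w : Sym2 (Fin n) → ℝ} {r : Fin n} {K : ℝ}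
  {D : Digraph (Fin n)} {L : EdgeList G m} {tail head : Fin m → Fin n}
  {lam : ℕ → ℝ} {par : ℕ → Fin n → Fin n} {s s' : Store}

/-- A listing of the arcs of `D`, each exactly once. -/
structure IsArcList (D : Digraph (Fin n)) (tail head : Fin m → Fin n) : Prop where
  adj_iff : ∀ u v, D.Adj u v ↔ ∃ i, tail i = u ∧ head i = v
  injective : Function.Injective fun i => (tail i, head i)

/-- The memory holds a parent packing of `t` trees, together with the residual weights of the arcs
and the difference between `K` and the value of the packing. -/
structure HoldsParentPacking (w : Sym2 (Fin n) → ℝ) (r : Fin n) (K : ℝ) (tail head : Fin m → Fin n)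
    (lam : ℕ → ℝ) (par : ℕ → Fin n → Fin n) (t : ℕ) (s : Store) : Prop where
  size : s.natVar NatReg.size = n
  edges : s.natVar NatReg.edges = m
  root : s.natVar NatReg.root = r
  trees : s.natVar NatReg.trees = t
  offset : s.natVar NatReg.offset = t * n
  tail_eq : ∀ i : Fin m, s.natArr NatArr.tail i = tail i
  head_eq : ∀ i : Fin m, s.natArr NatArr.head i = head i
  capacity : ∀ i : Fin m, s.realArr RealArr.capacity i = residual w lam par t (tail i) (head i)
  remaining : s.realVar RealReg.remaining = K - ∑ j ∈ Finset.range t, lam j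
  coeff : ∀ j < t, s.realArr RealArr.coeff j = lam j
  tree : ∀ j < t, ∀ v : Fin n, v ≠ r → s.natArr NatArr.tree (j * n + v) = par j v

/-- List the arcs of the orientation with their weights. -/
def listArcsProg : Prog :=
  .forTo NatReg.index NatReg.edges
    (.branch (.natLe (.get NatArr.flag (.var NatReg.index)) (.lit 0))
      (.putNat NatArr.tail (.var NatReg.index) (.get NatArr.src (.var NatReg.index)) ⨾
        .putNat NatArr.head (.var NatReg.index) (.get NatArr.dst (.var NatReg.index)))
      (.putNat NatArr.tail (.var NatReg.index) (.get NatArr.dst (.var NatReg.index)) ⨾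
        .putNat NatArr.head (.var NatReg.index) (.get NatArr.src (.var NatReg.index))) ⨾
    .putReal RealArr.capacity (.var NatReg.index) (.get RealArr.weight (.var NatReg.index)))

theorem listArcsProg_runs (h : HasInput L w r s) :
    Runs listArcsProg s fun T s' => T ≤ 40 * m + 7 ∧ ∃ tail head : Fin m → Fin n,
      IsArcList (outDigraph L s) tail head ∧ ∀ i : Fin m, s'.natArr NatArr.tail i = tail i ∧
        s'.natArr NatArr.head i = head i ∧
        s'.realArr RealArr.capacity i = w s(tail i, head i) := by
  let tail (i : Fin m) := if s.natArr 2 i = 0 then L.src i else L.dst i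
  let head (i : Fin m) := if s.natArr 2 i = 0 then L.dst i else L.src i
  have hedge (i) : s(tail i, head i) = s(L.src i, L.dst i) := by
    by_cases hi : s.natArr 2 i = 0 <;> simp [tail, head, hi, Sym2.eq_swap]
  refine (Runs.forTo (N := m) (fun i s' => ∀ j : Fin m, j < i →
    s'.natArr NatArr.tail j = tail j ∧ s'.natArr NatArr.head j = head j ∧
      s'.realArr RealArr.capacity j = w s(tail j, head j)) 31
    h.edges (by decide) (by decide) (by decide) (by simp) ?_).mono ?_
  · intro i s' hi hs' hx hI
    have h' := h.of_frame hs' (by decide)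
    have hflag : s'.natArr NatArr.flag i = s.natArr 2 i := by rw [hs'.natArr _ (by decide)]
    have hsrc := h'.src ⟨i, hi⟩
    have hdst := h'.dst ⟨i, hi⟩
    have hweight := h'.weight ⟨i, hi⟩
    rw [← hedge] at hweight
    dsimp only at hsrc hdst hweight
    simp only [runs_seq, runs_branch, runs_putNat, runs_putReal, BExp.Holds, NExp.eval, RExp.eval,
      Nat.le_zero, hx, hflag]
    refine ⟨fun hb => ⟨by decide, fun j hj => ?_⟩, fun hb => ⟨by decide, fun j hj => ?_⟩⟩
    all_goals
      rcases Nat.lt_succ_iff_lt_or_eq.1 hj with hj | rfl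
    · simpa [hj.ne] using hI j hj
    · simp [tail, head, hb, hsrc, hdst, hweight]
    · simpa [hj.ne] using hI j hj
    · simp [tail, head, hb, hsrc, hdst, hweight]
  · rintro T s' - ⟨hT, hI⟩
    refine ⟨by omega, tail, head, ⟨fun u v => ?_, fun i j hij => ?_⟩, fun i => hI i i.2⟩
    · refine exists_congr fun i => ?_
      by_cases hi : s.natArr 2 i = 0 <;> simp [tail, head, hi, @eq_comm _ u, @eq_comm _ v]
    · obtain ⟨htail, hhead⟩ := Prod.mk.inj hij
      exact L.injective (by simp only [← hedge, htail, hhead])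

/-- List the arcs, and start with the empty packing. -/
def startPackProg : Prog :=
  listArcsProg ⨾ .setNat NatReg.trees (.lit 0) ⨾ .setNat NatReg.offset (.lit 0) ⨾
    .setReal RealReg.remaining (.var RealReg.value)

theorem startPackProg_runs (h : HasInput L w r s) :
    Runs startPackProg s fun T s' => T ≤ 40 * m + 13 ∧ ∃ tail head : Fin m → Fin n,
      IsArcList (outDigraph L s) tail head ∧
        HoldsParentPacking w r (s.realVar RealReg.value) tail head 0
          (fun _ => id) 0 s' := by
  rw [startPackProg, runs_seq]
  refine (listArcsProg_runs h).mono ?_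
  rintro T s' hs' ⟨hT, tail, head, harcs, hI⟩
  have h' := h.of_frame hs' (by decide)
  simp only [runs_seq, runs_setNat, runs_setReal]
  refine ⟨by simp only [NExp.cost, RExp.cost]; omega, tail, head, harcs, ?_⟩
  constructor <;>
    simp [h'.size, h'.edges, h'.root, hI, residual, hs'.realVar RealReg.value (by decide)]

/-- The registers and arrays that hold a parent packing. -/
def packLocs : List Loc :=
  [.natVar NatReg.size, .natVar NatReg.edges, .natVar NatReg.root, .natVar NatReg.trees,
    .natVar NatReg.offset, .natArr NatArr.tail, .natArr NatArr.head, .natArr NatArr.tree,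
    .realArr RealArr.capacity, .realArr RealArr.coeff, .realVar RealReg.remaining]

theorem HoldsParentPacking.of_frame {W : List Loc}
    (h : HoldsParentPacking w r K tail head lam par t s) (hs : Frame W s s')
    (hW : ∀ x ∈ packLocs, x ∉ W) : HoldsParentPacking w r K tail head lam par t s' where
  size := (hs.natVar _ (hW _ (by decide))).trans h.size
  edges := (hs.natVar _ (hW _ (by decide))).trans h.edges
  root := (hs.natVar _ (hW _ (by decide))).trans h.root
  trees := (hs.natVar _ (hW _ (by decide))).trans h.trees
  offset := (hs.natVar _ (hW _ (by decide))).trans h.offset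
  tail_eq i := (congrFun (hs.natArr _ (hW _ (by decide))) i).trans (h.tail_eq i)
  head_eq i := (congrFun (hs.natArr _ (hW _ (by decide))) i).trans (h.head_eq i)
  capacity i := (congrFun (hs.realArr _ (hW _ (by decide))) i).trans (h.capacity i)
  remaining := (hs.realVar _ (hW _ (by decide))).trans h.remaining
  coeff j hj := (congrFun (hs.realArr _ (hW _ (by decide))) j).trans (h.coeff j hj)
  tree j hj v hv := (congrFun (hs.natArr _ (hW _ (by decide))) _).trans (h.tree j hj v hv)

/-- The array `entering` holds, for each vertex `v ≠ r`, the index of the arc from `p v` to `v`. -/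
def HoldsEntering (r : Fin n) (tail head : Fin m → Fin n) (p : Fin n → Fin n) (s : Store) : Prop :=
  ∀ v, v ≠ r → ∃ i : Fin m, s.natArr NatArr.entering v = i ∧ tail i = p v ∧ head i = v

/-- Choose an arc of positive residual weight that enters each vertex other than the root. -/
def enterProg : Prog :=
  .forTo NatReg.index NatReg.edges
    (.branch (.realLe (.get RealArr.capacity (.var NatReg.index)) .zero) .skip
      (.putNat NatArr.entering (.get NatArr.head (.var NatReg.index)) (.var NatReg.index)))

theorem enterProg_runs (h : HoldsParentPacking w r K tail head lam par t s)
    (hpos : ∀ v, v ≠ r → ∃ i, head i = v ∧ 0 < residual w lam par t (tail i) v) :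
    Runs enterProg s fun T s' => T ≤ 20 * m + 7 ∧ ∃ p, HoldsEntering r tail head p s' ∧
      ∀ v, v ≠ r → 0 < residual w lam par t (p v) v := by
  refine (Runs.forTo (N := m) (fun i s' => ∀ v,
    (∃ j : Fin m, j < i ∧ head j = v ∧ 0 < residual w lam par t (tail j) v) → ∃ j : Fin m,
      s'.natArr NatArr.entering v = j ∧ head j = v ∧ 0 < residual w lam par t (tail j) v) 11
    h.edges (by decide) (by decide) (by decide) (by simp) ?_).mono ?_
  · intro i s' hi hs' hx hI
    have h' := h.of_frame hs' (by decide)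
    have hcap := h'.capacity ⟨i, hi⟩
    have hhead := h'.head_eq ⟨i, hi⟩
    dsimp only at hcap hhead
    simp only [runs_branch, runs_skip, runs_putNat, BExp.Holds, NExp.eval, RExp.eval, hx, hcap,
      hhead, not_le]
    refine ⟨fun hle => ⟨by decide, fun v hv => hI v ?_⟩, fun hlt => ⟨by decide, fun v hv => ?_⟩⟩
    · obtain ⟨j, hj, rfl, hjpos⟩ := hv
      refine ⟨j, (Nat.lt_succ_iff_lt_or_eq.1 hj).resolve_right ?_, rfl, hjpos⟩
      rintro rfl
      exact hle.not_gt hjpos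
    · by_cases hvi : v = head ⟨i, hi⟩
      · exact ⟨⟨i, hi⟩, by simp [hvi], hvi.symm, hvi ▸ hlt⟩
      · obtain ⟨j, hj, hjv, hjpos⟩ := hv
        have hij : (j : ℕ) ≠ i := fun hij => hvi (by rw [← hjv]; congr; exact Fin.ext hij)
        simpa [Fin.val_ne_of_ne hvi] using hI v ⟨j, by omega, hjv, hjpos⟩
  · rintro T s' - ⟨hT, hI⟩
    have hI' (v) (hv : v ≠ r) : ∃ u, (∃ j : Fin m, s'.natArr NatArr.entering v = j ∧ tail j = u ∧
        head j = v) ∧ 0 < residual w lam par t u v := by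
      obtain ⟨i, hiv, hi⟩ := hpos v hv
      obtain ⟨j, hj, hjv, hjpos⟩ := hI v ⟨i, i.2, hiv, hi⟩
      exact ⟨tail j, ⟨j, hj, rfl, hjv⟩, hjpos⟩
    have : Nonempty (Fin n) := ⟨r⟩
    choose! p hp hppos using hI'
    exact ⟨by omega, p, hp, hppos⟩

/-- Choose the next tree, and the largest coefficient that it can get. -/
def chooseTreeProg : Prog :=
  enterProg ⨾ .setReal RealReg.increment (.var RealReg.remaining) ⨾
    minProg RealReg.increment (.get RealArr.capacity (.get NatArr.entering (.var NatReg.index)))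

theorem chooseTreeProg_runs (h : HoldsParentPacking w r K tail head lam par t s)
    (hpos : ∀ v, v ≠ r → ∃ i, head i = v ∧ 0 < residual w lam par t (tail i) v) :
    Runs chooseTreeProg s fun T s' => T ≤ 20 * m + 36 * n + 16 ∧
      ∃ p, HoldsEntering r tail head p s' ∧
        (∀ v, v ≠ r → 0 < residual w lam par t (p v) v) ∧
        IsLeast (insert (s.realVar RealReg.remaining)
          {y | ∃ v, v ≠ r ∧ y = residual w lam par t (p v) v}) (s'.realVar RealReg.increment) := by
  simp only [chooseTreeProg, runs_seq, runs_setReal]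
  refine (enterProg_runs h hpos).mono ?_
  rintro T₁ s₁ hs₁ ⟨hT₁, p, hp, hppos⟩
  have h₁ := h.of_frame hs₁ (by decide)
  refine (minProg_runs (r := r)
    (f := fun v => s₁.realArr RealArr.capacity (s₁.natArr NatArr.entering v)) ?_ ?_ ?_).mono ?_
  · exact h₁.size
  · exact h₁.root
  · intro v s' hs' hv
    simp only [RExp.eval, NExp.eval, hv, hs'.realArr RealArr.capacity (by decide),
      hs'.natArr NatArr.entering (by decide)]
  · rintro T₂ s₂ hs₂ ⟨hT₂, hmin⟩
    have hf (v) (hv : v ≠ r) : s₁.realArr RealArr.capacity (s₁.natArr NatArr.entering v) =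
        residual w lam par t (p v) v := by
      obtain ⟨i, hi, htail, hhead⟩ := hp v hv
      rw [hi, h₁.capacity, htail, hhead]
    refine ⟨by simp only [RExp.cost, NExp.cost] at hT₂ ⊢; omega, p, ?_, hppos, ?_⟩
    · simpa only [HoldsEntering, hs₂.natArr NatArr.entering (by decide)] using hp
    · have hset : {y | ∃ v, v ≠ r ∧ y = residual w lam par t (p v) v} = {y | ∃ v, v ≠ r ∧
          y = s₁.realArr RealArr.capacity (s₁.natArr NatArr.entering v)} := by
        ext y
        exact exists_congr fun v => and_congr_right fun hv => by rw [hf v hv]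
      rw [hset]
      simpa [hs₁.realVar RealReg.remaining (by decide)] using hmin

/-- Write the parent function of the chosen tree, and lower the residual weights of its arcs. -/
def emitTreeProg : Prog :=
  .forTo NatReg.index NatReg.size
    (.branch (.both (.natLe (.var NatReg.index) (.var NatReg.root))
        (.natLe (.var NatReg.root) (.var NatReg.index)))
      .skip
      (.putNat NatArr.tree (.plus (.var NatReg.offset) (.var NatReg.index))
          (.get NatArr.tail (.get NatArr.entering (.var NatReg.index))) ⨾
        .putReal RealArr.capacity (.get NatArr.entering (.var NatReg.index))
          (.minus (.get RealArr.capacity (.get NatArr.entering (.var NatReg.index)))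
            (.var RealReg.increment))))

open Classical in
/-- The effect of `emitTreeProg` after the vertices below `k`. -/
structure IsEmitted (w : Sym2 (Fin n) → ℝ) (r : Fin n) (tail head : Fin m → Fin n) (lam : ℕ → ℝ)
    (par : ℕ → Fin n → Fin n) (t : ℕ) (p : Fin n → Fin n) (c : ℝ) (s : Store) (k : ℕ)
    (s' : Store) : Prop where
  old_tree : ∀ x < t * n, s'.natArr NatArr.tree x = s.natArr NatArr.tree x
  new_tree : ∀ v : Fin n, v < k → v ≠ r → s'.natArr NatArr.tree (t * n + v) = p v
  capacity : ∀ i : Fin m, s'.realArr RealArr.capacity i =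
    residual w lam par t (tail i) (head i) - if head i < k ∧ p (head i) = tail i then c else 0

theorem IsEmitted.succ_root {p : Fin n → Fin n} {c : ℝ}
    (h : IsEmitted w r tail head lam par t p c s r s') (hr : ∀ i, head i ≠ r) :
    IsEmitted w r tail head lam par t p c s (r + 1) s' := by
  have hlt {v : Fin n} (hv : v ≠ r) : (v : ℕ) < r + 1 ↔ (v : ℕ) < r := by
    have := Fin.val_ne_of_ne hv
    omega
  refine ⟨h.old_tree, fun v hvr hv => h.new_tree v ((hlt hv).1 hvr) hv, fun i => ?_⟩
  simpa only [hlt (hr i)] using h.capacity i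

theorem IsEmitted.succ {p : Fin n → Fin n} {c : ℝ} {s₁ s₂ : Store} {v : Fin n} {e : Fin m}
    (h : IsEmitted w r tail head lam par t p c s v s₁) (harcs : IsArcList D tail head)
    (htail : tail e = p v) (hhead : head e = v)
    (htree : s₂.natArr NatArr.tree =
      Function.update (s₁.natArr NatArr.tree) (t * n + v) (p v))
    (hcap : s₂.realArr RealArr.capacity = Function.update (s₁.realArr RealArr.capacity) e
      (s₁.realArr RealArr.capacity e - c)) :
    IsEmitted w r tail head lam par t p c s (v + 1) s₂ := by
  refine ⟨fun x hx => ?_, fun u huv hu => ?_, fun i => ?_⟩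
  · simpa [htree, show x ≠ t * n + v by omega] using h.old_tree x hx
  · rcases Nat.lt_succ_iff_lt_or_eq.1 huv with huv | huv
    · simpa [htree, huv.ne] using h.new_tree u huv hu
    · rw [Fin.ext huv, htree, Function.update_self]
  · by_cases hie : i = e
    · simp [hcap, hie, h.capacity e, hhead, htail]
    · have hpi : (head i : ℕ) < v + 1 ∧ p (head i) = tail i ↔
          (head i : ℕ) < v ∧ p (head i) = tail i := by
        refine and_congr_left fun hpi => ?_
        have hne : head i ≠ v := fun hiv =>
          hie (harcs.injective (Prod.mk.injEq .. ▸ ⟨by rw [← hpi, hiv, htail], by rw [hiv, hhead]⟩))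
        have := Fin.val_ne_of_ne hne
        omega
      simpa only [hcap, hpi, Function.update_of_ne (Fin.val_ne_of_ne hie)] using h.capacity i

theorem emitTreeProg_runs (h : HoldsParentPacking w r K tail head lam par t s)
    (harcs : IsArcList D tail head) (hr : ∀ u, ¬ D.Adj u r) {p : Fin n → Fin n}
    (hp : HoldsEntering r tail head p s) :
    Runs emitTreeProg s fun T s' => T ≤ 40 * n + 7 ∧
      IsEmitted w r tail head lam par t p (s.realVar RealReg.increment) s n s' := by
  refine (Runs.forTo (N := n)
    (IsEmitted w r tail head lam par t p (s.realVar RealReg.increment) s) 31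
    h.size (by decide) (by decide) (by decide) ⟨by simp, by simp, by simp [h.capacity]⟩ ?_).mono ?_
  · intro k s' hk hs' hx hI
    have hroot : s'.natVar NatReg.root = r := by rw [hs'.natVar _ (by decide), h.root]
    have hoffset : s'.natVar NatReg.offset = t * n := by rw [hs'.natVar _ (by decide), h.offset]
    have hinc := hs'.realVar RealReg.increment (by decide)
    simp only [runs_branch, runs_skip, runs_seq, runs_putNat, runs_putReal, BExp.Holds, NExp.eval,
      RExp.eval, hx, hroot, hoffset, hinc, ← le_antisymm_iff]
    refine ⟨fun hkr => ⟨by decide, ?_⟩, fun hkr => ⟨by decide, ?_⟩⟩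
    · subst hkr
      obtain ⟨htree, htree', hcap⟩ :=
        hI.succ_root fun i hi => hr (tail i) ((harcs.adj_iff _ _).2 ⟨i, rfl, hi⟩)
      exact ⟨htree, htree', hcap⟩
    · obtain ⟨e, he, htail, hhead⟩ := hp ⟨k, hk⟩ fun hkr' => hkr (by rw [← hkr'])
      have hentering : s'.natArr NatArr.entering k = e := by rw [hs'.natArr _ (by decide), he]
      have htail' : s'.natArr NatArr.tail e = p ⟨k, hk⟩ := by
        rw [hs'.natArr _ (by decide), h.tail_eq, htail]
      exact hI.succ (v := ⟨k, hk⟩) harcs htail hhead (by simp [hentering, htail'])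
        (by simp [hentering])
  · rintro T s' - ⟨hT, hI⟩
    exact ⟨by omega, hI⟩

/-- Record the coefficient of the chosen tree. -/
def recordProg : Prog :=
  .putReal RealArr.coeff (.var NatReg.trees) (.var RealReg.increment) ⨾
  .setNat NatReg.trees (.plus (.var NatReg.trees) (.lit 1)) ⨾
  .setNat NatReg.offset (.plus (.var NatReg.offset) (.var NatReg.size)) ⨾
  .setReal RealReg.remaining (.minus (.var RealReg.remaining) (.var RealReg.increment))

theorem recordProg_runs (h : HoldsParentPacking w r K tail head lam par t s)
    (hs' : Frame emitTreeProg.writes s s') {p : Fin n → Fin n} {c : ℝ}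
    (hc : s.realVar RealReg.increment = c) (hI : IsEmitted w r tail head lam par t p c s n s') :
    Runs recordProg s' fun T s'' => T ≤ 16 ∧ HoldsParentPacking w r K tail head
      (Function.update lam t c) (Function.update par t p) (t + 1) s'' := by
  have htrees : s'.natVar NatReg.trees = t := by rw [hs'.natVar _ (by decide), h.trees]
  have hoffset : s'.natVar NatReg.offset = t * n := by rw [hs'.natVar _ (by decide), h.offset]
  have hsize : s'.natVar NatReg.size = n := by rw [hs'.natVar _ (by decide), h.size]
  have hinc : s'.realVar RealReg.increment = c := by rw [hs'.realVar _ (by decide), hc]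
  simp only [recordProg, runs_seq, runs_setNat, runs_setReal, runs_putReal, NExp.eval, RExp.eval,
    htrees, hinc]
  refine ⟨by decide, ?_⟩
  constructor
  case capacity =>
    intro i
    simp [hI.capacity i, residual_succ_update]
  case coeff =>
    intro j hj
    rcases Nat.lt_succ_iff_lt_or_eq.1 hj with hj | rfl
    · simp [hj.ne, hs'.realArr RealArr.coeff (by decide), h.coeff j hj]
    · simp
  case tree =>
    intro j hj v hv
    rcases Nat.lt_succ_iff_lt_or_eq.1 hj with hj | rfl
    · have hlt : j * n + v < t * n := by
        have := Nat.mul_le_mul_right n hj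
        rw [Nat.succ_mul] at this
        omega
      simp [hj.ne, hI.old_tree _ hlt, h.tree j hj v hv]
    · simp [hI.new_tree v v.2 hv]
  case remaining =>
    have hsum : ∑ j ∈ Finset.range t, Function.update lam t c j = ∑ j ∈ Finset.range t, lam j :=
      Finset.sum_congr rfl fun j hj => Function.update_of_ne (Finset.mem_range.1 hj).ne _ _
    simp [hs'.realVar RealReg.remaining (by decide), h.remaining, Finset.sum_range_succ, hsum,
      sub_add_eq_sub_sub]
  all_goals
    simp [hoffset, hsize, Nat.succ_mul, hs'.natVar NatReg.edges (by decide), h.edges,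
      hs'.natVar NatReg.root (by decide), h.root, hs'.natArr NatArr.tail (by decide), h.tail_eq,
      hs'.natArr NatArr.head (by decide), h.head_eq]

/-- Add one tree to the packing. -/
def addTreeProg : Prog := chooseTreeProg ⨾ emitTreeProg ⨾ recordProg

theorem addTreeProg_runs (h : HoldsParentPacking w r K tail head lam par t s)
    (harcs : IsArcList D tail head) (hr : ∀ u, ¬ D.Adj u r)
    (hpos : ∀ v, v ≠ r → ∃ i, head i = v ∧ 0 < residual w lam par t (tail i) v) :
    Runs addTreeProg s fun T s' => T ≤ 20 * m + 76 * n + 40 ∧ ∃ p c,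
      (∀ v, v ≠ r → 0 < residual w lam par t (p v) v ∧ ∃ i, tail i = p v ∧ head i = v) ∧
      IsLeast (insert (s.realVar RealReg.remaining)
        {y | ∃ v, v ≠ r ∧ y = residual w lam par t (p v) v}) c ∧
      HoldsParentPacking w r K tail head (Function.update lam t c) (Function.update par t p) (t + 1)
        s' := by
  simp only [addTreeProg, runs_seq]
  refine (chooseTreeProg_runs h hpos).mono ?_
  rintro T₁ s₁ hs₁ ⟨hT₁, p, hp, hppos, hmin⟩
  have h₁ := h.of_frame hs₁ (by decide)
  refine (emitTreeProg_runs h₁ harcs hr hp).mono ?_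
  rintro T₂ s₂ hs₂ ⟨hT₂, hI⟩
  refine (recordProg_runs h₁ hs₂ rfl hI).mono ?_
  rintro T₃ s₃ - ⟨hT₃, h₃⟩
  refine ⟨by omega, p, _, fun v hv => ⟨hppos v hv, ?_⟩, hmin, h₃⟩
  obtain ⟨i, -, hi⟩ := hp v hv
  exact ⟨i, hi⟩

open Classical in
/-- The number of arcs of positive residual weight. -/
noncomputable def numLive (w : Sym2 (Fin n) → ℝ) (tail head : Fin m → Fin n) (lam : ℕ → ℝ)
    (par : ℕ → Fin n → Fin n) (t : ℕ) : ℕ :=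
  (Finset.univ.filter fun i => 0 < residual w lam par t (tail i) (head i)).card

theorem numLive_update_lt {c : ℝ} {p : Fin n → Fin n} (hc : 0 < c) (i : Fin m)
    (hp : p (head i) = tail i) (hi : residual w lam par t (tail i) (head i) = c) :
    numLive w tail head (Function.update lam t c) (Function.update par t p) (t + 1) <
      numLive w tail head lam par t := by
  refine Finset.card_lt_card ((Finset.ssubset_iff_of_subset fun j hj => ?_).2 ⟨i, ?_, ?_⟩)
  · rw [Finset.mem_filter_univ, residual_succ_update] at hj
    rw [Finset.mem_filter_univ]
    split_ifs at hj <;> linarith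
  · rwa [Finset.mem_filter_univ, hi]
  · rw [Finset.mem_filter_univ, residual_succ_update, if_pos hp, hi, sub_self]
    exact lt_irrefl 0

theorem addTreeProg_isParentPacking (h : HoldsParentPacking w r K tail head lam par t s)
    (hpack : IsParentPacking D w r lam par t) (harcs : IsArcList D tail head)
    (hr : ∀ u, ¬ D.Adj u r) (hK : ∀ v, v ≠ r → K ≤ inWeight D w v)
    (hlt : ∑ j ∈ Finset.range t, lam j < K) :
    Runs addTreeProg s fun T s' => T ≤ 20 * m + 76 * n + 40 ∧ ∃ lam' par',
      IsParentPacking D w r lam' par' (t + 1) ∧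
      HoldsParentPacking w r K tail head lam' par' (t + 1) s' ∧
      (∑ j ∈ Finset.range (t + 1), lam' j = K ∨
        ∑ j ∈ Finset.range (t + 1), lam' j < K ∧
          numLive w tail head lam' par' (t + 1) < numLive w tail head lam par t) := by
  refine (addTreeProg_runs h harcs hr fun v hv => ?_).mono ?_
  · obtain ⟨u, huv, hpos⟩ := hpack.exists_residual_pos hv (hlt.trans_le (hK v hv))
    obtain ⟨i, rfl, rfl⟩ := (harcs.adj_iff u v).1 huv
    exact ⟨i, rfl, hpos⟩
  rintro T s' - ⟨hT, p, c, hp, ⟨hcmem, hcle⟩, h'⟩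
  have hc : 0 < c := by
    rcases hcmem with rfl | ⟨v, hv, rfl⟩
    exacts [h.remaining ▸ sub_pos.2 hlt, (hp v hv).1]
  have hadj (v) (hv : v ≠ r) : D.Adj (p v) v := (harcs.adj_iff _ _).2 (hp v hv).2
  refine ⟨hT, _, _, hpack.update hr hc hadj fun v hv => hcle (.inr ⟨v, hv, rfl⟩), h', ?_⟩
  have hle : c ≤ K - ∑ j ∈ Finset.range t, lam j := h.remaining ▸ hcle (.inl rfl)
  have hsum : ∑ j ∈ Finset.range (t + 1), Function.update lam t c j =
      ∑ j ∈ Finset.range t, lam j + c := by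
    rw [Finset.sum_range_succ, Function.update_self]
    exact congrArg (· + c) (Finset.sum_congr rfl fun j hj =>
      Function.update_of_ne (Finset.mem_range.1 hj).ne _ _)
  rw [hsum]
  refine (le_sub_iff_add_le'.1 hle).eq_or_lt.imp_right fun hlt' => ⟨hlt', ?_⟩
  rcases hcmem with hc_eq | ⟨v, hv, hc_eq⟩
  · rw [hc_eq, h.remaining, add_sub_cancel] at hlt'
    exact absurd hlt' (lt_irrefl K)
  · obtain ⟨-, i, htail, hhead⟩ := hp v hv
    exact numLive_update_lt hc i (by rw [hhead, htail]) (by rw [hc_eq, hhead, htail])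

/-- Compute a packing of value `value` of arborescences of the orientation in the memory. -/
def packProg : Prog :=
  startPackProg ⨾ .loop (.neg (.realLe (.var RealReg.remaining) .zero)) addTreeProg

theorem packProg_isParentPacking (h : HasInput L w r s) (hw : ∀ e ∈ G.edgeSet, 0 ≤ w e)
    (hD : IsRootedAcyclic G r (outDigraph L s)) (hK₀ : 0 ≤ s.realVar RealReg.value)
    (hK : ∀ v, v ≠ r → s.realVar RealReg.value ≤ inWeight (outDigraph L s) w v) :
    Runs packProg s fun T s' => T ≤ (m + 1) * (20 * m + 76 * n + 45) + 40 * m + 18 ∧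
      ∃ lam par t, ∃ tail head : Fin m → Fin n,
        IsParentPacking (outDigraph L s) w r lam par t ∧
        HoldsParentPacking w r (s.realVar RealReg.value) tail head lam par t s' ∧
        ∑ j ∈ Finset.range t, lam j = s.realVar RealReg.value := by
  simp only [packProg, runs_seq]
  refine (startPackProg_runs h).mono ?_
  rintro T₁ s₁ - ⟨hT₁, tail, head, harcs, h₁⟩
  refine (Runs.loop (k := (m + 1) * (20 * m + 76 * n + 45)) (fun k s' => ∃ lam par t,
    IsParentPacking (outDigraph L s) w r lam par t ∧
    HoldsParentPacking w r (s.realVar RealReg.value) tail head lam par t s' ∧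
    (∑ j ∈ Finset.range t, lam j = s.realVar RealReg.value ∨
      ∑ j ∈ Finset.range t, lam j < s.realVar RealReg.value ∧
        (numLive w tail head lam par t + 1) * (20 * m + 76 * n + 45) ≤ k)) ?_ ?_).mono ?_
  · refine ⟨_, _, 0, ⟨by simp, by simp, fun u v huv => ?_⟩, h₁, ?_⟩
    · simpa [residual] using hw _ (hD.adj huv)
    · refine (hK₀.eq_or_lt.imp_right fun hK₀ => ⟨hK₀, Nat.mul_le_mul_right _ ?_⟩)
      exact Nat.succ_le_succ ((Finset.card_le_univ _).trans_eq (Fintype.card_fin m))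
  · rintro k s' - ⟨lam, par, t, hpack, h', hlive⟩ hb
    have hlt : ∑ j ∈ Finset.range t, lam j < s.realVar RealReg.value := by
      simpa [h'.remaining] using hb
    refine (addTreeProg_isParentPacking h' hpack harcs ((hD.source_iff r).2 rfl) hK hlt).mono ?_
    rintro T s'' - ⟨hT, lam', par', hpack', h'', hlive'⟩
    obtain ⟨-, hk⟩ := hlive.resolve_left hlt.ne
    rw [Nat.succ_mul] at hk
    refine ⟨k - (20 * m + 76 * n + 45), ⟨lam', par', t + 1, hpack', h'',
      hlive'.imp_right (And.imp_right fun hlt' => ?_)⟩, ?_⟩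
    · exact (Nat.mul_le_mul_right _ (Nat.succ_le_of_lt hlt')).trans (by omega)
    · simp only [BExp.cost, RExp.cost]
      omega
  · rintro T₂ s₂ - ⟨hT₂, ⟨k, -, lam, par, t, hpack, h₂, hlive⟩, hb⟩
    refine ⟨by simp only [BExp.cost, RExp.cost] at hT₂; omega, lam, par, t, tail, head, hpack, h₂,
      hlive.resolve_right fun ⟨hlt, _⟩ => hb ?_⟩
    simpa [h₂.remaining] using hlt

theorem HoldsParentPacking.isPacking (h : HoldsParentPacking w r K tail head lam par t s)
    (hpack : IsParentPacking D w r lam par t) (hD : ∀ v, ¬ Relation.TransGen D.Adj v v) :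
    IsPacking D w r (outCoeff s) (outTree s r) ∧
      ∑ j, outCoeff s j = ∑ j ∈ Finset.range t, lam j := by
  obtain rfl : s.natVar 3 = t := h.trees
  have hcoeff : outCoeff s = fun j : Fin (s.natVar 3) => lam j := funext fun j => h.coeff j j.2
  have htree : outTree s r = fun j : Fin (s.natVar 3) => parentDigraph r (par j) := by
    funext j
    ext u v
    refine and_congr_right fun hv => ?_
    rw [← Fin.val_inj, ← h.tree j j.2 v hv]
  rw [hcoeff, htree]
  exact ⟨hpack.isPacking hD, Fin.sum_univ_eq_sum_range lam _⟩

theorem packProg_runs (h : IsSolved L w r s) (hw : ∀ e ∈ G.edgeSet, 0 ≤ w e) :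
    Runs packProg s fun T s' => T ≤ (m + 1) * (20 * m + 76 * n + 45) + 40 * m + 18 ∧
      IsPacking (outDigraph L s) w r (outCoeff s') (outTree s' r) ∧
      ∑ j, outCoeff s' j = s.realVar RealReg.value := by
  have hK₀ : 0 ≤ s.realVar RealReg.value := by
    obtain ⟨v, -, hv⟩ := h.isLeast.1
    exact hv ▸ inWeight_nonneg (fun u v huv => hw _ (h.rootedAcyclic.adj huv)) v
  refine (packProg_isParentPacking h.input hw h.rootedAcyclic hK₀ fun v hv =>
    h.isLeast.2 ⟨v, hv, rfl⟩).mono ?_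
  rintro T s' - ⟨hT, lam, par, t, tail, head, hpack, h', hsum⟩
  obtain ⟨hpacking, hvalue⟩ := h'.isPacking hpack h.rootedAcyclic.acyclic
  exact ⟨hT, hpacking, hvalue.trans hsum⟩

end PackingProgram

section Algorithms

variable {n m : ℕ} {G : SimpleGraph (Fin n)} {w : Sym2 (Fin n) → ℝ} {r r₀ : Fin n}
  {L : EdgeList G m} {s s' : Store}

theorem IsSolved.of_frame {W : List Loc} (h : IsSolved L w r s) (hs : Frame W s s')
    (hW : ∀ x ∈ .natArr NatArr.flag :: .realVar RealReg.value :: inputLocs, x ∉ W) :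
    IsSolved L w r s' ∧ outDigraph L s' = outDigraph L s ∧
      s'.realVar RealReg.value = s.realVar RealReg.value := by
  have hflag : s'.natArr 2 = s.natArr 2 := hs.natArr NatArr.flag (hW _ (by simp))
  have hdigraph : outDigraph L s' = outDigraph L s := by rw [outDigraph, outDigraph, hflag]
  have hvalue := hs.realVar RealReg.value (hW _ (by simp))
  refine ⟨⟨h.input.of_frame hs fun x hx => hW x (by simp [hx]), ?_, ?_, ?_⟩, hdigraph, hvalue⟩
  · exact hdigraph ▸ h.rootedAcyclic
  · exact hdigraph ▸ hvalue ▸ h.isLeast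
  · exact hvalue ▸ h.le_value

theorem IsSolved.isGreatest_packingValues (h : IsSolved L w r s)
    (hw : ∀ e ∈ G.edgeSet, 0 ≤ w e) :
    IsGreatest (packingValues (outDigraph L s) w r) (s.realVar RealReg.value) := by
  obtain ⟨-, s', -, -, hpack, hvalue⟩ := packProg_runs h hw
  exact Broadcast.isGreatest_packingValues h.isLeast ⟨_, _, _, hpack, hvalue.symm⟩

theorem IsSolved.isGreatest_rootedValues (h : IsSolved L w r s)
    (hw : ∀ e ∈ G.edgeSet, 0 ≤ w e) :
    IsGreatest (rootedValues G w r) (s.realVar RealReg.value) :=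
  Broadcast.isGreatest_rootedValues hw h.rootedAcyclic (h.isGreatest_packingValues hw) h.le_value

theorem IsSolved.value_eq (h : IsSolved L w r s) (hw : ∀ e ∈ G.edgeSet, 0 ≤ w e) :
    s.realVar RealReg.value = kRooted G w r :=
  (h.isGreatest_rootedValues hw).csSup_eq.symm

theorem IsSolved.holdsOrientation (h : IsSolved L w r s) (hw : ∀ e ∈ G.edgeSet, 0 ≤ w e) :
    HoldsOrientation L w r s where
  rootedAcyclic := h.rootedAcyclic
  value := h.value_eq hw
  min_inWeight := h.value_eq hw ▸ h.isLeast
  max_packing := (h.isGreatest_packingValues hw).csSup_eq.trans (h.value_eq hw)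
  max_orientation := h.value_eq hw ▸ h.isGreatest_rootedValues hw

theorem ncard_le_card {V : Type*} [Finite V] (S : Set V) : S.ncard ≤ Nat.card V :=
  Set.ncard_univ V ▸ Set.ncard_le_ncard S.subset_univ

/-- Solve rBRP. -/
def rootedProg : Prog := solveProg ⨾ packProg

theorem rootedProg_runs (hG : G.Connected) (hn : 2 ≤ n) (hw : ∀ e ∈ G.edgeSet, 0 ≤ w e)
    (h : HasInput L w r s) :
    Runs rootedProg s fun T s' => T ≤ 1000 * (n + m + 1) ^ 2 ∧ HoldsRootedSolution L w r s' := by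
  rw [rootedProg, runs_seq]
  refine (solveProg_runs hG hn hw (fun l _ => ncard_le_card _) h).mono ?_
  rintro T₁ s₁ - ⟨hT₁, h₁⟩
  refine (packProg_runs h₁ hw).mono ?_
  rintro T₂ s₂ hs₂ ⟨hT₂, hpack, hsum⟩
  obtain ⟨h₂, hdigraph, -⟩ := h₁.of_frame hs₂ (by decide)
  rw [Nat.card_fin] at hT₁
  refine ⟨by nlinarith, h₂.holdsOrientation hw, hdigraph ▸ hpack, hsum.trans (h₁.value_eq hw), ?_⟩
  exact h₂.value_eq hw ▸ h₂.isGreatest_packingValues hw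

theorem HasInput.update_root {W : List Loc} (h : HasInput L w r₀ s) (hs : Frame W s s')
    (hW : ∀ x ∈ inputLocs.erase (.natVar NatReg.root), x ∉ W) (r : Fin n) :
    HasInput L w r { s' with natVar := Function.update s'.natVar NatReg.root r } where
  size := (hs.natVar NatReg.size (hW _ (by decide))).trans h.size
  edges := (hs.natVar NatReg.edges (hW _ (by decide))).trans h.edges
  root := by simp
  src i := (congrFun (hs.natArr NatArr.src (hW _ (by decide))) i).trans (h.src i)
  dst i := (congrFun (hs.natArr NatArr.dst (hW _ (by decide))) i).trans (h.dst i)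
  weight i := (congrFun (hs.realArr RealArr.weight (hW _ (by decide))) i).trans (h.weight i)

theorem kRooted_nonneg {V : Type*} (G : SimpleGraph V) (w : Sym2 V → ℝ) (r : V) :
    0 ≤ kRooted G w r := by
  refine Real.sSup_nonneg ?_
  rintro _ ⟨D, -, rfl⟩
  refine Real.sSup_nonneg ?_
  rintro _ ⟨t, lam, A, h, rfl⟩
  exact Finset.sum_nonneg fun j _ => (h.pos j).le

/-- Solve the problem for the root `candidate`, and remember this root if its value is at least the
best value so far. -/
def candidateProg : Prog :=
  .setNat NatReg.root (.var NatReg.candidate) ⨾ solveProg ⨾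
    .branch (.realLe (.var RealReg.best) (.var RealReg.value))
      (.setReal RealReg.best (.var RealReg.value) ⨾
        .setNat NatReg.bestRoot (.var NatReg.candidate))
      .skip

/-- Find a root of maximum value. -/
def rootProg : Prog :=
  .setReal RealReg.best .zero ⨾ .setNat NatReg.bestRoot (.lit 0) ⨾
    .forTo NatReg.candidate NatReg.size candidateProg

theorem candidateProg_runs (hG : G.Connected) (hn : 2 ≤ n) (hw : ∀ e ∈ G.edgeSet, 0 ≤ w e)
    (hs : HasInput L w r { s with natVar := Function.update s.natVar NatReg.root r })
    (hr : s.natVar NatReg.candidate = r) :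
    Runs candidateProg s fun T s' => T ≤ 600 * ((n + 1) * m) + 12 ∧
      s'.realVar RealReg.best = max (s.realVar RealReg.best) (kRooted G w r) ∧
      (s'.natVar NatReg.bestRoot = if s.realVar RealReg.best ≤ kRooted G w r then (r : ℕ) else
        s.natVar NatReg.bestRoot) := by
  simp only [candidateProg, runs_seq, runs_setNat, NExp.eval, hr]
  refine (solveProg_runs hG hn hw (fun l _ => ncard_le_card _) hs).mono ?_
  rintro T₁ s₁ hs₁ ⟨hT₁, h₁⟩
  rw [Nat.card_fin] at hT₁
  have hbest : s₁.realVar RealReg.best = s.realVar RealReg.best := hs₁.realVar _ (by decide)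
  have hroot : s₁.natVar NatReg.bestRoot = s.natVar NatReg.bestRoot := by
    rw [hs₁.natVar _ (by decide)]; rfl
  have hcand : s₁.natVar NatReg.candidate = r := by
    rw [hs₁.natVar _ (by decide)]; exact hr
  simp only [runs_branch, runs_seq, runs_setNat, runs_setReal, runs_skip, BExp.Holds, RExp.eval,
    NExp.eval, h₁.value_eq hw, hbest, hroot, hcand]
  refine ⟨fun h => ⟨?_, ?_, ?_⟩, fun h => ⟨?_, ?_, ?_⟩⟩
  · simp only [BExp.cost, NExp.cost, RExp.cost]; omega
  · simp [h]
  · simp [h]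
  · simp only [BExp.cost, NExp.cost, RExp.cost]; omega
  · simp [(not_le.1 h).le]
  · simp [h]

theorem rootProg_runs (hG : G.Connected) (hn : 2 ≤ n) (hw : ∀ e ∈ G.edgeSet, 0 ≤ w e)
    (h : HasInput L w r s) :
    Runs rootProg s fun T s' => T ≤ n * (600 * ((n + 1) * m) + 21) + 11 ∧
      ∃ r₁ : Fin n, s'.natVar NatReg.bestRoot = r₁ ∧ ∀ r', kRooted G w r' ≤ kRooted G w r₁ := by
  simp only [rootProg, runs_seq, runs_setReal, runs_setNat]
  have hinput : HasInput L w r { s with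
      natVar := Function.update s.natVar NatReg.bestRoot 0
      realVar := Function.update s.realVar RealReg.best 0 } :=
    ⟨h.size, h.edges, h.root, h.src, h.dst, h.weight⟩
  refine (Runs.forTo (N := n) (fun i s' => (∃ r₁ : Fin n, s'.natVar NatReg.bestRoot = r₁ ∧
      s'.realVar RealReg.best ≤ kRooted G w r₁) ∧
      ∀ r' : Fin n, r' < i → kRooted G w r' ≤ s'.realVar RealReg.best) (600 * ((n + 1) * m) + 12)
    hinput.size (by decide) (by decide) (by decide) ⟨⟨⟨0, by omega⟩, ?_⟩, by simp⟩ ?_).mono ?_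
  · simp [kRooted_nonneg]
  · rintro i s' hi hs' hx ⟨⟨r₁, hr₁, hle⟩, hmax⟩
    refine (candidateProg_runs (r := ⟨i, hi⟩) hG hn hw
      (hinput.update_root hs' (by decide) _) hx).mono ?_
    rintro T s'' - ⟨hT, hbest, hroot⟩
    refine ⟨hT, ?_, fun r' hr' => ?_⟩
    · by_cases hi' : s'.realVar RealReg.best ≤ kRooted G w ⟨i, hi⟩
      · exact ⟨⟨i, hi⟩, hroot.trans (if_pos hi'), (hbest.trans (max_eq_right hi')).le⟩
      · exact ⟨r₁, hroot.trans ((if_neg hi').trans hr₁),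
          by rwa [hbest, max_eq_left (not_le.1 hi').le]⟩
    · rw [hbest]
      obtain hr' | rfl : r' < i ∨ r' = ⟨i, hi⟩ := by
        rw [Fin.ext_iff]
        exact Nat.lt_succ_iff_lt_or_eq.1 hr'
      exacts [(hmax r' hr').trans (le_max_left ..), le_max_right ..]
  · rintro T s' - ⟨hT, ⟨r₁, hr₁, hle⟩, hmax⟩
    refine ⟨?_, r₁, hr₁, fun r' => (hmax r' r'.2).trans hle⟩
    simp only [NExp.cost, RExp.cost]
    linarith

/-- Solve BRP. -/
def broadcastProg : Prog :=
  rootProg ⨾ .setNat NatReg.root (.var NatReg.bestRoot) ⨾ rootedProg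

theorem broadcastProg_runs (hG : G.Connected) (hn : 2 ≤ n) (hw : ∀ e ∈ G.edgeSet, 0 ≤ w e)
    (h : HasInput L w r s) :
    Runs broadcastProg s fun T s' => T ≤ 2000 * (n + m + 1) ^ 3 ∧ HoldsSolution L w s' := by
  rw [broadcastProg, runs_seq]
  refine (rootProg_runs hG hn hw h).mono ?_
  rintro T₁ s₁ hs₁ ⟨hT₁, r₁, hr₁, hmax⟩
  rw [runs_seq, runs_setNat, NExp.eval, hr₁]
  have h₁ := h.update_root hs₁ (by decide) r₁
  refine (rootedProg_runs hG hn hw h₁).mono ?_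
  rintro T₂ s₂ hs₂ ⟨hT₂, h₂⟩
  refine ⟨?_, r₁, (hs₂.natVar _ (by decide)).trans h₁.root, h₂, ⟨r₁, rfl⟩, ?_⟩
  · have hsq : n * (600 * ((n + 1) * m) + 21) ≤ 630 * (n + m + 1) ^ 3 := by
      have hnm : (n + 1) * m ≤ (n + m + 1) ^ 2 := by
        rw [sq]; exact Nat.mul_le_mul (by omega) (by omega)
      have hone : 1 ≤ (n + m + 1) ^ 2 := Nat.one_le_pow _ _ (by omega)
      calc n * (600 * ((n + 1) * m) + 21)
        _ ≤ (n + m + 1) * (630 * (n + m + 1) ^ 2) := Nat.mul_le_mul (by omega) (by omega)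
        _ = 630 * (n + m + 1) ^ 3 := by ring
    simp only [NExp.cost]
    nlinarith
  · rintro _ ⟨r', rfl⟩
    exact hmax r'

end Algorithms

section Graphs

variable {V : Type*} {G : SimpleGraph V}

theorem ncard_edgeSet_sub_le_numChords [Finite V] {u : V} {c : G.Walk u u} (hc : c.IsCycle) :
    G.edgeSet.ncard - Nat.card V ≤ numChords c := by
  classical
  have := Fintype.ofFinite V
  have hlen : c.edges.toFinset.card ≤ Nat.card V := calc
    c.edges.toFinset.card ≤ c.edges.length := List.toFinset_card_le _
    _ = c.support.tail.length := by simp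
    _ ≤ Nat.card V := Nat.card_eq_fintype_card (α := V) ▸ hc.support_nodup.length_le_card
  rw [← Set.ncard_coe_finset, List.coe_toFinset] at hlen
  exact (Nat.sub_le_sub_left hlen _).trans (Set.le_ncard_sdiff _ _)

theorem IsTwoConnected.nontrivial (h : IsTwoConnected G) : Nontrivial V := by
  have hV := h.three_le
  have : Finite V := Nat.finite_of_card_ne_zero (by omega)
  rw [← Finite.one_lt_card_iff_nontrivial]
  omega

theorem IsTwoConnected.nontrivial_neighborSet (h : IsTwoConnected G) (v : V) :
    (G.neighborSet v).Nontrivial := by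
  have hV := h.three_le
  have : Finite V := Nat.finite_of_card_ne_zero (by omega)
  have : Nontrivial V := h.nontrivial
  obtain ⟨u, hvu⟩ := h.connected.preconnected.exists_adj_of_nontrivial v
  have : Nontrivial ({u}ᶜ : Set V) := by
    rw [← Finite.one_lt_card_iff_nontrivial, Nat.card_coe_set_eq, Set.ncard_compl,
      Set.ncard_singleton]
    omega
  obtain ⟨⟨x, hxu⟩, hvx⟩ := (h.no_cut u).preconnected.exists_adj_of_nontrivial ⟨v, hvu.ne⟩
  exact ⟨u, hvu, x, hvx, Ne.symm hxu⟩

end Graphs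

end Broadcast

theorem theorem3p10_general :
    (∃ (P : Broadcast.Prog) (C : ℕ), ∀ (n m : ℕ) (G : SimpleGraph (Fin n))
      (L : Broadcast.EdgeList G m) (w : Sym2 (Fin n) → ℝ) (r : Fin n),
      G.Connected → (∀ v, (G.neighborSet v).Nontrivial) → (∀ e ∈ G.edgeSet, 0 ≤ w e) →
      ∃ (T : ℕ) (s : Broadcast.Store),
        Broadcast.Exec P (Broadcast.inputStore L w r) T s ∧
        Broadcast.HoldsOrientation L w r s ∧
        (∀ (u : Fin n) (c : G.Walk u u), c.IsCycle →
          T ≤ C * ((Broadcast.numChords c + 1) * m)) ∧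
        T ≤ C * ((m - n + 1) * m)) ∧
    (∃ (P : Broadcast.Prog) (p : Polynomial ℕ), ∀ (n m : ℕ) (G : SimpleGraph (Fin n))
      (L : Broadcast.EdgeList G m) (w : Sym2 (Fin n) → ℝ) (r : Fin n),
      G.Connected → 2 ≤ n → (∀ e ∈ G.edgeSet, 0 ≤ w e) →
      ∃ (T : ℕ) (s : Broadcast.Store),
        Broadcast.Exec P (Broadcast.inputStore L w r) T s ∧
        Broadcast.HoldsRootedSolution L w r s ∧
        T ≤ p.eval (n + m)) ∧
    (∃ (P : Broadcast.Prog) (p : Polynomial ℕ), ∀ (n m : ℕ) (G : SimpleGraph (Fin n))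
      (L : Broadcast.EdgeList G m) (w : Sym2 (Fin n) → ℝ),
      G.Connected → 2 ≤ n → (∀ e ∈ G.edgeSet, 0 ≤ w e) →
      ∃ (T : ℕ) (s : Broadcast.Store),
        Broadcast.Exec P (Broadcast.inputStore L w 0) T s ∧
        Broadcast.HoldsSolution L w s ∧
        T ≤ p.eval (n + m)) := by
  refine ⟨⟨Broadcast.solveProg, 1800, fun n m G L w r hG hdeg hw => ?_⟩,
    ⟨Broadcast.rootedProg, 1000 * (.X + 1) ^ 2, fun n m G L w r hG hn hw => ?_⟩,
    ⟨Broadcast.broadcastProg, 2000 * (.X + 1) ^ 3, fun n m G L w hG hn hw => ?_⟩⟩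
  · have hn : 2 ≤ n := Fin.nontrivial_iff_two_le.1 (Set.nontrivial_of_nontrivial (hdeg r))
    obtain ⟨T, s, he, hT, hs⟩ := Broadcast.solveProg_runs hG hn hw
      (fun l hl => hl.ncard_frontier_le hdeg) (Broadcast.hasInput_inputStore L w r)
    rw [L.ncard_edgeSet, Nat.card_fin] at hT
    have hT' : T ≤ 1800 * ((m - n + 1) * m) := hT.trans (by nlinarith)
    refine ⟨T, s, he, hs.holdsOrientation hw, fun u c hc => hT'.trans ?_, hT'⟩
    have hchords := Broadcast.ncard_edgeSet_sub_le_numChords hc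
    rw [L.ncard_edgeSet, Nat.card_fin] at hchords
    gcongr
  · obtain ⟨T, s, he, hT, hs⟩ :=
      Broadcast.rootedProg_runs hG hn hw (Broadcast.hasInput_inputStore L w r)
    exact ⟨T, s, he, hs, by simpa using hT⟩
  · obtain ⟨T, s, he, hT, hs⟩ := Broadcast.broadcastProg_runs hG hn hw
      (Broadcast.hasInput_inputStore L w ⟨0, by omega⟩)
    exact ⟨T, s, he, hs, by simpa using hT⟩

theorem theorem3p10 :
    -- an optimal `r`-acyclic orientation in `O((k + 1) m)` steps
    (∃ (P : Broadcast.Prog) (C : ℕ), ∀ (n m : ℕ) (G : SimpleGraph (Fin n))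
      (L : Broadcast.EdgeList G m) (w : Sym2 (Fin n) → ℝ) (r : Fin n),
      Broadcast.IsTwoConnected G → Broadcast.IsOuterplanar G → (∀ e ∈ G.edgeSet, 0 ≤ w e) →
      ∃ (T : ℕ) (s : Broadcast.Store),
        Broadcast.Exec P (Broadcast.inputStore L w r) T s ∧
        Broadcast.HoldsOrientation L w r s ∧
        (∀ (u : Fin n) (c : G.Walk u u), Broadcast.IsOuterCircuit c →
          T ≤ C * ((Broadcast.numChords c + 1) * m)) ∧
        T ≤ C * ((m - n + 1) * m)) ∧
    -- rBRP in polynomial time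
    (∃ (P : Broadcast.Prog) (p : Polynomial ℕ), ∀ (n m : ℕ) (G : SimpleGraph (Fin n))
      (L : Broadcast.EdgeList G m) (w : Sym2 (Fin n) → ℝ) (r : Fin n),
      Broadcast.IsTwoConnected G → Broadcast.IsOuterplanar G → (∀ e ∈ G.edgeSet, 0 ≤ w e) →
      ∃ (T : ℕ) (s : Broadcast.Store),
        Broadcast.Exec P (Broadcast.inputStore L w r) T s ∧
        Broadcast.HoldsRootedSolution L w r s ∧
        T ≤ p.eval (n + m)) ∧
    -- BRP in polynomial time
    (∃ (P : Broadcast.Prog) (p : Polynomial ℕ), ∀ (n m : ℕ) (G : SimpleGraph (Fin n))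
      (L : Broadcast.EdgeList G m) (w : Sym2 (Fin n) → ℝ),
      Broadcast.IsTwoConnected G → Broadcast.IsOuterplanar G → (∀ e ∈ G.edgeSet, 0 ≤ w e) →
      ∃ (T : ℕ) (s : Broadcast.Store),
        Broadcast.Exec P (Broadcast.inputStore L w 0) T s ∧
        Broadcast.HoldsSolution L w s ∧
        T ≤ p.eval (n + m)) := by
  obtain ⟨⟨P, C, hP⟩, ⟨Q, p, hQ⟩, ⟨R, q, hR⟩⟩ := theorem3p10_general
  refine ⟨⟨P, C, fun n m G L w r hG _ hw => ?_⟩,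
    ⟨Q, p, fun n m G L w r hG _ =>
      hQ n m G L w r hG.connected (Fin.nontrivial_iff_two_le.1 hG.nontrivial)⟩,
    ⟨R, q, fun n m G L w hG _ =>
      hR n m G L w hG.connected (Fin.nontrivial_iff_two_le.1 hG.nontrivial)⟩⟩
  obtain ⟨T, s, he, hs, hc, hT⟩ := hP n m G L w r hG.connected hG.nontrivial_neighborSet hw
  exact ⟨T, s, he, hs, fun u c h => hc u c h.1, hT⟩
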